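/- An abelian group $A$ *has no free summand* if $A=A_0\oplus A_1$ with $A_0$ free implies $A_0=0$. For a prime $p$, the *$p$-corank* of $A$ is the dimension of $A/pA$ over $\mathbb{Z}/p\mathbb{Z}$. Write $\mathbb{Z}(p^\infty)$ for the Prüfer $p$-group and $A^{(\kappa)}$ for the direct sum of $\kappa$ copies of $A$. $\mathrm{Ext}(\Lambda,\mathbb{Z})$ denotes the group of extensions of $\Lambda$ by $\mathbb{Z}$, i.e. normalized symmetric $2$-cocycles $\Lambda\times\Lambda\to\mathbb{Z}$ modulo coboundaries. Given $d\ge 1$ and a group $\Lambda'$ without free summand such that $\mathbb{Z}^d\subseteq\Lambda'\subseteq\mathbb{Q}^d$, write $\Lambda'=\bigcup_m\Lambda_{(m)}$ for an increasing sequence of finitely generated subgroups with $\Lambda_{(0)}=\mathbb{Z}^d$, put $\Lambda^{(m)}=\{x\in\mathbb{Z}^d:\langle x,y\rangle\in\mathbb{Z}\text{ for all }y\in\Lambda_{(m)}\}$, where $\langle x,y\rangle=\sum_i x_iy_i$, and let $\hat{\mathbb{Z}}^d_{\Lambda'}=\varprojlim_m\mathbb{Z}^d/\Lambda^{(m)}$,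 which contains a canonical copy of $\mathbb{Z}^d$. For a rank $d$ subgroup $\Lambda$ of $\mathbb{Q}^d$ without free summand, $\hat{\mathbb{Z}}^d_\Lambda$ denotes $\hat{\mathbb{Z}}^d_{\Lambda'}$ for any such $\Lambda'$ isomorphic to $\Lambda$ ($\Lambda'=\Lambda$ being allowed if $\mathbb{Z}^d\subseteq\Lambda$) and any such sequence $(\Lambda_{(m)})$. **Theorem.** 1. Let $d\ge 1$, let $\Lambda\subseteq\mathbb{Q}^d$ be a subgroup of rank $d$ without free summand, and for each prime $p$ let $n_p$ be the $p$-corank of $\Lambda$. Then $n_p\in\{0,1,\dots,d\}$ and $[\Lambda:p\Lambda]=p^{n_p}$ for all $p$, and, as abstract groups (for every choice of $\Lambda'$ and $(\Lambda_{(m)})$ above), $$\hat{\mathbb{Z}}^d_\Lambda/\mathbb{Z}^d\;\cong\;\mathbb{Q}^{(2^{\aleph_0})}\oplus\bigoplus_{p\text{ prime}}\mathbb{Z}(p^\infty)^{n_p}.$$ 2. Let $\Lambda$ be a torsion-free abelian group of finite rank $d\ge 1$ without free summand, with $p$-coranks $n_p$. Then $n_p\in\{0,1,\dots,d\}$ and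 $[\Lambda:p\Lambda]=p^{n_p}$ for every prime $p$, and, as abstract groups, $$\mathrm{Ext}(\Lambda,\mathbb{Z})\;\cong\;\mathbb{Q}^{(2^{\aleph_0})}\oplus\bigoplus_{p\text{ prime}}\mathbb{Z}(p^\infty)^{n_p}.$$ 3. Let $\Lambda$ and $\Lambda'$ be nonzero torsion-free abelian groups of finite (possibly different) ranks without free summands. Then $\mathrm{Ext}(\Lambda,\mathbb{Z})$ and $\mathrm{Ext}(\Lambda',\mathbb{Z})$ are isomorphic as abstract groups if and only if $[\Lambda:p\Lambda]=[\Lambda':p\Lambda']$ for every prime $p$. -/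

import Mathlib

noncomputable section

/-- An abelian group has no free summand if in every internal decomposition `A = A₀ ⊕ A₁` with
`A₀` free abelian, one has `A₀ = 0`. -/
def NoFreeSummand (A : Type*) [AddCommGroup A] : Prop :=
  ∀ A₀ A₁ : Submodule ℤ A, IsCompl A₀ A₁ → Module.Free ℤ A₀ → A₀ = ⊥

/-- The `p`-corank of `A`: the dimension of `A / pA` over the field with `p` elements. -/
def pCorank (p : ℕ) (A : Type*) [AddCommGroup A] : ℕ :=
  Module.finrank (ZMod p) (ModN A p)

/-- The index `[A : pA]` (equal to `0` when it is infinite). -/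
def pIndex (p : ℕ) (A : Type*) [AddCommGroup A] : ℕ :=
  (nsmulAddMonoidHom (α := A) p).range.index

/-- The Prüfer group `ℤ(p^∞)`, as the `p`-primary component of `ℚ / ℤ`. -/
abbrev Prufer (p : Nat.Primes) : Type :=
  AddCommGroup.primaryComponent (ℚ ⧸ AddSubgroup.zmultiples (1 : ℚ)) (p : ℕ)

/-- The group `ℚ^(2^ℵ₀) ⊕ ⨁_p ℤ(p^∞)^(n p)`, where `p` ranges over the primes. The index set
`ℕ → Bool` of the first direct sum has cardinality `2^ℵ₀`. -/
abbrev ModelGroup (n : Nat.Primes → ℕ) : Type :=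
  ((ℕ → Bool) →₀ ℚ) × DirectSum Nat.Primes (fun p => Fin (n p) → Prufer p)

/-- The subgroup `ℤ^d` of `ℚ^d`. -/
def intLattice (d : ℕ) : AddSubgroup (Fin d → ℚ) :=
  ((Int.castAddHom ℚ).compLeft (Fin d)).range

/-- A rank `d` cofiltration: an increasing sequence of finitely generated subgroups of `ℚ^d`
starting at `ℤ^d` (hence all of rank `d`), whose union has no free summand. -/
structure Cofiltration (d : ℕ) where
  term : ℕ → AddSubgroup (Fin d → ℚ)
  mono : Monotone term
  term_zero : term 0 = intLattice d
  fg : ∀ m, (term m).FG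
  noFreeSummand : NoFreeSummand (⨆ m, term m : AddSubgroup (Fin d → ℚ))

namespace Cofiltration

variable {d : ℕ} (F : Cofiltration d)

/-- The union of a cofiltration (the supremum of an increasing sequence of subgroups). -/
def union : AddSubgroup (Fin d → ℚ) := ⨆ m, F.term m

/-- Every subgroup of `ℚ^d` that contains `ℤ^d` and has no free summand is the union of a
cofiltration, so its completion is available. -/
theorem exists_union_eq (Λ : AddSubgroup (Fin d → ℚ)) (h : intLattice d ≤ Λ)
    (hn : NoFreeSummand Λ) : ∃ F : Cofiltration d, F.union = Λ := by
  let t : ℕ → AddSubgroup (Fin d → ℚ) := fun m =>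
    intLattice d ⊔ AddSubgroup.closure {l | l ∈ Λ ∧ Encodable.encode l < m}
  have hu : (⨆ m, t m) = Λ := by
    apply le_antisymm
    · refine iSup_le fun m => sup_le h ?_
      rw [AddSubgroup.closure_le]
      exact fun l hl => hl.1
    · intro l hl
      refine (le_iSup t (Encodable.encode l + 1)) ?_
      exact (le_sup_right : _ ≤ t _) (AddSubgroup.subset_closure ⟨hl, Nat.lt_succ_self _⟩)
  refine ⟨⟨t, ?_, ?_, ?_, ?_⟩, hu⟩
  · intro m n hmn
    exact sup_le_sup le_rfl (AddSubgroup.closure_mono fun l hl => ⟨hl.1, hl.2.trans_le hmn⟩)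
  · simp [t]
  · intro m
    have h1 : (intLattice d).FG := by
      rw [← AddGroup.fg_iff_addSubgroup_fg]
      exact AddGroup.fg_of_surjective (f := ((Int.castAddHom ℚ).compLeft (Fin d)).rangeRestrict)
        (AddMonoidHom.rangeRestrict_surjective _)
    refine AddSubgroup.FG.sup h1 ?_
    have hfin : {l | l ∈ Λ ∧ Encodable.encode l < m}.Finite :=
      ((Set.finite_lt_nat m).preimage Encodable.encode_injective.injOn).subset fun l hl => hl.2
    exact ⟨hfin.toFinset, by simp⟩
  · show NoFreeSummand ↥(⨆ m, t m)
    rw [hu]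
    exact hn

/-- The `m`-th term of the dual filtration of `ℤ^d`: the annihilator of `F.term m` under the
pairing `⟨x, y⟩ = ∑ i, x i * y i` modulo `ℤ`. As `F.term m` contains the standard basis vectors,
every vector that pairs integrally with it is in `ℤ^d`, so only integer vectors are listed. -/
def dual (m : ℕ) : AddSubgroup (Fin d → ℤ) where
  carrier := {x | ∀ y ∈ F.term m, ∃ k : ℤ, ∑ i, (x i : ℚ) * y i = (k : ℚ)}
  zero_mem' := fun y _ => ⟨0, by simp⟩
  add_mem' := by
    intro a b ha hb y hy
    obtain ⟨k, hk⟩ := ha y hy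
    obtain ⟨l, hl⟩ := hb y hy
    exact ⟨k + l, by simp [add_mul, Finset.sum_add_distrib, hk, hl]⟩
  neg_mem' := by
    intro a ha y hy
    obtain ⟨k, hk⟩ := ha y hy
    exact ⟨-k, by simp [hk]⟩

theorem dual_anti {m n : ℕ} (h : m ≤ n) : F.dual n ≤ F.dual m :=
  fun _ hx y hy => hx y (F.mono h hy)

/-- The projection `ℤ^d / Λ^(n) → ℤ^d / Λ^(m)` for `m ≤ n`. -/
def transition {m n : ℕ} (h : m ≤ n) : (Fin d → ℤ) ⧸ F.dual n →+ (Fin d → ℤ) ⧸ F.dual m :=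
  QuotientAddGroup.map (F.dual n) (F.dual m) (AddMonoidHom.id _) (F.dual_anti h)

/-- The profinite completion `lim_m ℤ^d / Λ^(m)` of `ℤ^d` along the dual filtration. -/
def completion : AddSubgroup (∀ m : ℕ, (Fin d → ℤ) ⧸ F.dual m) where
  carrier := {x | ∀ (m n : ℕ) (h : m ≤ n), F.transition h (x n) = x m}
  zero_mem' := fun m n h => by simp
  add_mem' := by
    intro a b ha hb m n h
    simp [ha m n h, hb m n h]
  neg_mem' := by
    intro a ha m n h
    simp [ha m n h]

/-- The canonical homomorphism from `ℤ^d` to its completion. -/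
def toCompletion : (Fin d → ℤ) →+ F.completion where
  toFun x := ⟨fun m => QuotientAddGroup.mk' (F.dual m) x, fun _ _ _ => rfl⟩
  map_zero' := rfl
  map_add' _ _ := rfl

/-- The quotient of the completion by the canonical copy of `ℤ^d`. -/
abbrev completionQuotient : Type := F.completion ⧸ F.toCompletion.range

end Cofiltration

namespace ExtGroup

variable (B F : Type*) [AddCommGroup B] [AddCommGroup F]

/-- Normalized symmetric 2-cocycles on `B` with coefficients in `F`. -/
def cocycles : AddSubgroup (B → B → F) where
  carrier := {c | (∀ x, c x 0 = 0 ∧ c 0 x = 0) ∧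
    (∀ x y z, c x y + c (x + y) z = c x (y + z) + c y z) ∧ ∀ x y, c x y = c y x}
  zero_mem' := by simp
  add_mem' := by
    rintro a b ⟨ha₁, ha₂, ha₃⟩ ⟨hb₁, hb₂, hb₃⟩
    refine ⟨fun x => by simp [ha₁ x, hb₁ x], fun x y z => ?_, fun x y => ?_⟩
    · have h : (a x y + a (x + y) z) + (b x y + b (x + y) z)
          = (a x (y + z) + a y z) + (b x (y + z) + b y z) := by rw [ha₂, hb₂]
      simp only [Pi.add_apply]
      rw [add_add_add_comm, h, add_add_add_comm]
    · simp [ha₃ x y, hb₃ x y]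
  neg_mem' := by
    rintro a ⟨ha₁, ha₂, ha₃⟩
    refine ⟨fun x => by simp [ha₁ x], fun x y z => ?_, fun x y => ?_⟩
    · have h := congrArg Neg.neg (ha₂ x y z)
      simp only [neg_add] at h
      exact h
    · simp [ha₃ x y]

/-- The cocycles of the form `c x y = h x + h y - h (x + y)`. -/
def coboundaries : AddSubgroup (cocycles B F) where
  carrier := {c | ∃ h : B → F, ∀ x y, c.1 x y = h x + h y - h (x + y)}
  zero_mem' := ⟨0, by simp⟩
  add_mem' := by
    rintro a b ⟨h, hh⟩ ⟨k, hk⟩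
    refine ⟨h + k, fun x y => ?_⟩
    simp only [AddSubgroup.coe_add, Pi.add_apply, hh, hk]
    abel
  neg_mem' := by
    rintro a ⟨h, hh⟩
    refine ⟨-h, fun x y => ?_⟩
    simp only [AddSubgroup.coe_neg, Pi.neg_apply, hh]
    abel

end ExtGroup

/-- `Ext(B, F)`: the group of extensions of `B` by `F`, as cocycles modulo coboundaries. -/
abbrev ExtGroup (B F : Type*) [AddCommGroup B] [AddCommGroup F] : Type _ :=
  ExtGroup.cocycles B F ⧸ ExtGroup.coboundaries B F

end

/-! Both groups are identified with the cokernel `C` of `Hom(Λ, ℚ) → Hom(Λ, ℚ/ℤ)`, and `C` is then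
determined by its divisibility, socles and cardinality.

`C` is divisible because `Λ` is torsion-free and `ℚ/ℤ` is injective. Since `Λ` has no free summand,
`Hom(Λ, ℤ) = 0`; hence the `p`-torsion of `C` is `Hom(Λ, (ℚ/ℤ)[p])`, the dual of `Λ/pΛ`, of order `p
^ n_p` (`card_charQuotient_torsion`). Finite rank makes `Λ` and `Hom(Λ, ℚ)` countable, while `Λ` is
not finitely generated and so has continuum many characters; thus `#C = 𝔠` (`mk_charQuotient`). A
divisible group with these socles and this cardinality is the model group
(`exists_equiv_modelGroup`).

For `Ext(Λ, ℤ)`, the functions `Λ → ℚ` that vanish at `0` and are additive modulo `ℤ` map onto both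
integral cocycles and characters; the induced maps onto `Ext(Λ, ℤ)` and `C` have the same kernel
(`quasiHoms.ker_eq`). For the completion, a compatible sequence of integer vectors is a character of
the union trivial on `ℤ^d`. Every class in `C` contains one, and those that lift to `ℚ` come from
`ℤ^d`.

Conversely, the order of the `p`-torsion of `Ext(Λ, ℤ)` is `[Λ : pΛ]`, so the isomorphism type
recovers all the indices. -/

/-! ### Structure of divisible abelian groups -/

section DivisibleGroups

open Cardinal

/-- An additive monoid is divisible if multiplication by every nonzero natural number is
surjective. -/
def IsDivisible (A : Type*) [AddMonoid A] : Prop :=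
  ∀ n : ℕ, n ≠ 0 → ∀ x : A, ∃ y : A, n • y = x

namespace IsDivisible

theorem of_surjective {A B : Type*} [AddMonoid A] [AddMonoid B] (hA : IsDivisible A)
    (f : A →+ B) (hf : Function.Surjective f) : IsDivisible B := by
  intro n hn x
  obtain ⟨a, rfl⟩ := hf x
  obtain ⟨b, rfl⟩ := hA n hn a
  exact ⟨f b, (map_nsmul f n b).symm⟩

theorem baer {D : Type*} [AddCommGroup D] (hD : IsDivisible D) : Module.Baer ℤ D := by
  let _ : DivisibleBy D ℤ := AddCommGroup.divisibleByIntOfSMulTopEqTop D (by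
    intro n hn
    refine eq_top_iff.mpr fun x _ => ?_
    obtain ⟨y, hy⟩ := hD n.natAbs (Int.natAbs_ne_zero.mpr hn) x
    refine ⟨n.sign • y, trivial, ?_⟩
    change n • n.sign • y = x
    rw [smul_smul, Int.mul_sign_self, ← hy, natCast_zsmul])
  exact Module.Baer.of_divisible D

/-- Homomorphisms to a divisible group extend along injective homomorphisms. -/
theorem exists_extension {A B D : Type*} [AddCommGroup A] [AddCommGroup B] [AddCommGroup D]
    (hD : IsDivisible D) (i : A →+ B) (hi : Function.Injective i) (f : A →+ D) :
    ∃ g : B →+ D, ∀ a, g (i a) = f a := by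
  obtain ⟨g, hg⟩ := hD.baer.extension_property_addMonoidHom i hi f
  exact ⟨g, fun a => DFunLike.congr_fun hg a⟩

theorem of_divisionRing (K : Type*) [DivisionRing K] [CharZero K] : IsDivisible K := by
  intro n hn x
  exact ⟨(n : K)⁻¹ * x, by rw [nsmul_eq_mul, mul_inv_cancel_left₀ (Nat.cast_ne_zero.mpr hn)]⟩

theorem pi {ι : Type*} {A : ι → Type*} [∀ i, AddMonoid (A i)] (h : ∀ i, IsDivisible (A i)) :
    IsDivisible (∀ i, A i) := by
  intro n hn x
  choose y hy using fun i => h i n hn (x i)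
  exact ⟨y, funext hy⟩

theorem directSum {ι : Type*} [DecidableEq ι] {A : ι → Type*} [∀ i, AddCommMonoid (A i)]
    (h : ∀ i, IsDivisible (A i)) : IsDivisible (DirectSum ι A) := by
  intro n hn x
  induction x using DirectSum.induction_on with
  | zero => exact ⟨0, smul_zero n⟩
  | of i x =>
    obtain ⟨y, rfl⟩ := h i n hn x
    exact ⟨DirectSum.of A i y, (map_nsmul _ _ _).symm⟩
  | add x y hx hy =>
    obtain ⟨a, rfl⟩ := hx
    obtain ⟨b, rfl⟩ := hy
    exact ⟨a + b, nsmul_add _ _ _⟩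

/-- Write `n = p ^ a * m` with `p ∤ m`. Division by `p ^ a` keeps the order a power of `p`, and `m`
acts invertibly on an element of `p`-power order, with a Bézout coefficient as inverse. -/
theorem primaryComponent {A : Type*} [AddCommGroup A] (hA : IsDivisible A) (p : ℕ)
    (hp : p.Prime) : IsDivisible (AddCommGroup.primaryComponent A p) := by
  rintro n hn ⟨x, k, hk⟩
  obtain ⟨a, m, hm, rfl⟩ := Nat.exists_eq_pow_mul_and_not_dvd hn p hp.ne_one
  obtain ⟨y, hy⟩ := hA (p ^ a) (pow_ne_zero _ hp.ne_zero) x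
  have hcop : Nat.Coprime m (p ^ (a + k)) :=
    Nat.Coprime.pow_right _ ((Nat.Prime.coprime_iff_not_dvd hp).mpr hm).symm
  have hy' : p ^ (a + k) • y = 0 := by rw [pow_add, mul_comm, mul_nsmul', hy, hk]
  have hbez := Nat.gcd_eq_gcd_ab m (p ^ (a + k))
  rw [hcop.gcd_eq_one] at hbez
  set u := Nat.gcdA m (p ^ (a + k))
  set v := Nat.gcdB m (p ^ (a + k))
  refine ⟨⟨u • y, a + k, ?_⟩, Subtype.ext ?_⟩
  · rw [smul_comm, hy', smul_zero]
  · change (p ^ a * m) • u • y = x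
    have : m • u • y = y := by
      rw [← natCast_zsmul, smul_smul]
      have h2 : (m : ℤ) * u = 1 - v * ((p ^ (a + k) : ℕ) : ℤ) := by
        push_cast at hbez ⊢; linarith
      rw [h2, sub_smul, one_smul, mul_smul, natCast_zsmul, hy', smul_zero, sub_zero]
    rw [mul_nsmul', this, hy]

end IsDivisible

theorem isDivisible_ratCircle : IsDivisible (AddCircle (1 : ℚ)) :=
  (IsDivisible.of_divisionRing ℚ).of_surjective
    (QuotientAddGroup.mk' (AddSubgroup.zmultiples (1 : ℚ))) (QuotientAddGroup.mk'_surjective _)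

/-- The elements of `ℚ / ℤ` killed by `n ≠ 0` form a set of cardinality `n`. -/
theorem card_ratCircle_torsion (n : ℕ) (hn : n ≠ 0) :
    Nat.card {x : AddCircle (1 : ℚ) // n • x = 0} = n := by
  have hn' : (n : ℚ) ≠ 0 := Nat.cast_ne_zero.mpr hn
  let f : ℤ →+ AddCircle (1 : ℚ) := (zmultiplesHom _) ((1 / n : ℚ) : AddCircle (1 : ℚ))
  have hf : ∀ k : ℤ, f k = ((k / n : ℚ) : AddCircle (1 : ℚ)) := by
    intro k
    simp only [f, zmultiplesHom_apply, ← AddCircle.coe_zsmul]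
    congr 1
    rw [zsmul_eq_mul]; ring
  have hfn : f n = 0 := by
    rw [hf, AddCircle.coe_eq_zero_iff]
    exact ⟨1, by simp [hn']⟩
  -- The classes of `k / n` are exactly the `n`-torsion, so `g` parametrizes it bijectively by `ZMod
  -- n`.
  let g : ZMod n →+ AddCircle (1 : ℚ) := ZMod.lift n ⟨f, hfn⟩
  have hg : ∀ k : ℤ, g (k : ZMod n) = f k := fun k => ZMod.lift_coe n ⟨f, hfn⟩ k
  have hinj : Function.Injective g := by
    rw [injective_iff_map_eq_zero]
    intro a ha
    obtain ⟨k, rfl⟩ := ZMod.intCast_surjective a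
    rw [hg, hf, AddCircle.coe_eq_zero_iff] at ha
    obtain ⟨m, hm⟩ := ha
    rw [ZMod.intCast_zmod_eq_zero_iff_dvd]
    refine ⟨m, ?_⟩
    have : (k : ℚ) = n * m := by
      rw [zsmul_eq_mul, mul_one] at hm
      rw [hm]; field_simp
    exact_mod_cast this
  have hrange : ∀ x, n • x = 0 ↔ x ∈ Set.range g := by
    intro x
    constructor
    · intro hx
      induction x using QuotientAddGroup.induction_on with
      | H q =>
        change n • (q : AddCircle (1 : ℚ)) = 0 at hx
        rw [← AddCircle.coe_nsmul, AddCircle.coe_eq_zero_iff] at hx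
        obtain ⟨m, hm⟩ := hx
        refine ⟨(m : ZMod n), ?_⟩
        rw [hg, hf]
        change ((m / n : ℚ) : AddCircle (1 : ℚ)) = (q : AddCircle (1 : ℚ))
        congr 1
        rw [zsmul_eq_mul, mul_one, nsmul_eq_mul] at hm
        rw [hm]; field_simp
    · rintro ⟨a, rfl⟩
      rw [← map_nsmul, nsmul_eq_mul]
      simp
  calc Nat.card {x : AddCircle (1 : ℚ) // n • x = 0} = Nat.card (Set.range g) :=
        Nat.card_congr (Equiv.subtypeEquivRight hrange)
    _ = n := by rw [Nat.card_range_of_injective hinj, Nat.card_zmod]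

theorem card_pi_torsion {A : Type*} [AddMonoid A] (n k : ℕ) :
    Nat.card {x : Fin k → A // n • x = 0} = Nat.card {x : A // n • x = 0} ^ k := by
  have e : {x : Fin k → A // n • x = 0} ≃ (Fin k → {x : A // n • x = 0}) :=
    (Equiv.subtypeEquivRight fun x => by simp [funext_iff]).trans
      (Equiv.subtypePiEquivPi (p := fun (_ : Fin k) (x : A) => n • x = 0))
  rw [Nat.card_congr e, Nat.card_fun, Nat.card_fin]

theorem card_prufer_pi_torsion (p : Nat.Primes) (k : ℕ) :
    Nat.card {x : Fin k → Prufer p // (p : ℕ) • x = 0} = (p : ℕ) ^ k := by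
  rw [card_pi_torsion]
  congr 1
  have e : {x : Prufer p // (p : ℕ) • x = 0} ≃
      {x : AddCircle (1 : ℚ) // (p : ℕ) • x = 0} :=
    { toFun := fun x => ⟨x.1.1, congrArg Subtype.val x.2⟩
      invFun := fun x => ⟨⟨x.1, 1, by rw [pow_one]; exact x.2⟩, Subtype.ext x.2⟩
      left_inv := fun _ => rfl
      right_inv := fun _ => rfl }
  rw [Nat.card_congr e, card_ratCircle_torsion _ p.2.ne_zero]

/-- If the elements of `A` killed by a prime `p` form a group of order `p ^ n`, then this group
is elementary abelian of rank `n`. -/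
theorem exists_socle_equiv_zmod {A : Type*} [AddCommGroup A] (p n : ℕ) (hp : p.Prime)
    (hA : Nat.card {x : A // p • x = 0} = p ^ n) :
    Nonempty (AddSubgroup.torsionBy A (p : ℤ) ≃+ (Fin n → ZMod p)) := by
  have : Fact p.Prime := ⟨hp⟩
  let _ : Module (ZMod p) (AddSubgroup.torsionBy A (p : ℤ)) := AddSubgroup.torsionBy.zmodModule
  have hcard : Nat.card (AddSubgroup.torsionBy A (p : ℤ)) = p ^ n := by
    rw [← hA]
    exact Nat.card_congr (Equiv.subtypeEquivRight fun x => AddSubgroup.torsionBy.nsmul_iff)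
  have : Finite (AddSubgroup.torsionBy A (p : ℤ)) :=
    Nat.finite_of_card_ne_zero (by rw [hcard]; exact pow_ne_zero _ hp.ne_zero)
  have hfr : Module.finrank (ZMod p) (AddSubgroup.torsionBy A (p : ℤ)) = n := by
    have h := Module.natCard_eq_pow_finrank (K := ZMod p)
      (V := AddSubgroup.torsionBy A (p : ℤ))
    rw [hcard, Nat.card_zmod] at h
    exact (Nat.pow_right_injective hp.two_le h).symm
  exact ⟨(LinearEquiv.ofFinrankEq _ _ (by rw [hfr]; simp)).toAddEquiv⟩

/-- A divisible group whose `p`-socle has order `p ^ n` receives a homomorphism from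
`ℤ(p^∞)^n` that restricts to a bijection of `p`-socles. -/
theorem exists_hom_from_prufer {D : Type*} [AddCommGroup D] (hD : IsDivisible D)
    (p : Nat.Primes) (n : ℕ) (hn : Nat.card {x : D // (p : ℕ) • x = 0} = (p : ℕ) ^ n) :
    ∃ g : (Fin n → Prufer p) →+ D, (∀ x, (p : ℕ) • x = 0 → g x = 0 → x = 0) ∧
      ∀ y : D, (p : ℕ) • y = 0 → ∃ x, g x = y := by
  obtain ⟨e⟩ := exists_socle_equiv_zmod p n p.2 hn
  obtain ⟨e'⟩ := exists_socle_equiv_zmod p n p.2 (card_prufer_pi_torsion p n)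
  -- Both socles are `(ZMod p) ^ n`; an isomorphism between them extends to all of `ℤ(p^∞)^n`
  -- because `D` is injective.
  let s := e'.trans e.symm
  obtain ⟨g, hg⟩ := hD.exists_extension
    (AddSubgroup.torsionBy (Fin n → Prufer p) ((p : ℕ) : ℤ)).subtype Subtype.val_injective
    ((AddSubgroup.torsionBy D ((p : ℕ) : ℤ)).subtype.comp s.toAddMonoidHom)
  refine ⟨g, fun x hx hgx => ?_, fun y hy => ?_⟩
  · have h := hg ⟨x, AddSubgroup.torsionBy.nsmul_iff.mpr hx⟩
    change g x = (s _ : D) at h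
    rw [hgx] at h
    have h0 : s ⟨x, AddSubgroup.torsionBy.nsmul_iff.mpr hx⟩ = 0 := Subtype.ext h.symm
    exact congrArg Subtype.val (s.map_eq_zero_iff.mp h0)
  · refine ⟨s.symm ⟨y, AddSubgroup.torsionBy.nsmul_iff.mpr hy⟩, ?_⟩
    have h := hg (s.symm ⟨y, AddSubgroup.torsionBy.nsmul_iff.mpr hy⟩)
    change g (s.symm _ : Fin n → Prufer p) = (s (s.symm _) : D) at h
    rw [h, s.apply_symm_apply]

/-- A homomorphism that is injective on all socles is injective on torsion elements. -/
theorem eq_zero_of_socle_injective {A B : Type*} [AddCommGroup A] [AddCommGroup B] (f : A →+ B)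
    (hf : ∀ p : ℕ, p.Prime → ∀ x : A, p • x = 0 → f x = 0 → x = 0) (N : ℕ) (hN : N ≠ 0)
    (x : A) (hx : N • x = 0) (hfx : f x = 0) : x = 0 := by
  induction N using Nat.recOnMul generalizing x with
  | zero => exact absurd rfl hN
  | one => rwa [one_smul] at hx
  | prime p hp => exact hf p hp x hx hfx
  | mul a b ha hb =>
    -- `b • x` is killed by `a` and lies in the kernel, so it vanishes; then `x` is killed by `b`.
    refine hb (right_ne_zero_of_mul hN) x (ha (left_ne_zero_of_mul hN) _ ?_ ?_) hfx
    · rw [← mul_smul, hx]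
    · rw [map_nsmul, hfx, smul_zero]

/-- A homomorphism from a divisible group that hits all socles hits all torsion elements. -/
theorem exists_preimage_of_socle_surjective {A B : Type*} [AddCommGroup A] [AddCommGroup B]
    (hA : IsDivisible A) (f : A →+ B)
    (hf : ∀ p : ℕ, p.Prime → ∀ y : B, p • y = 0 → ∃ x, f x = y) (N : ℕ) (hN : N ≠ 0)
    (y : B) (hy : N • y = 0) : ∃ x, f x = y := by
  induction N using Nat.recOnMul generalizing y with
  | zero => exact absurd rfl hN
  | one => exact ⟨0, by rw [map_zero, ← hy, one_smul]⟩
  | prime p hp => exact hf p hp y hy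
  | mul a b ha hb =>
    -- Lift `b • y`, divide the lift by `b` in `A`, and correct by a preimage of an element killed
    -- by `b`.
    obtain ⟨x, hx⟩ := ha (left_ne_zero_of_mul hN) (b • y) (by rw [← mul_smul, hy])
    obtain ⟨z, rfl⟩ := hA b (right_ne_zero_of_mul hN) x
    obtain ⟨w, hw⟩ := hb (right_ne_zero_of_mul hN) (y - f z) (by
      rw [smul_sub, ← hx, map_nsmul, sub_self])
    exact ⟨w + z, by rw [map_add, hw, sub_add_cancel]⟩

theorem exists_pow_nsmul_eq_zero_prufer_pi (p : Nat.Primes) (k : ℕ) (x : Fin k → Prufer p) :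
    ∃ a : ℕ, (p : ℕ) ^ a • x = 0 := by
  choose a ha using fun i => (x i).2
  -- The sum of the exponents serves as a common exponent for the finitely many coordinates.
  refine ⟨∑ i, a i, funext fun i => Subtype.ext ?_⟩
  change (p : ℕ) ^ (∑ i, a i) • (x i : ℚ ⧸ AddSubgroup.zmultiples (1 : ℚ)) = 0
  rw [← Finset.sum_erase_add _ _ (Finset.mem_univ i), pow_add, mul_smul]
  exact (congrArg _ (ha i)).trans (smul_zero _)

/-- The torsion part `⨁_p ℤ(p^∞)^(n p)` of the model group. -/
abbrev PruferSum (n : Nat.Primes → ℕ) : Type :=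
  DirectSum Nat.Primes (fun p => Fin (n p) → Prufer p)

namespace PruferSum

variable (n : Nat.Primes → ℕ)

theorem exists_nsmul_eq_zero (x : PruferSum n) : ∃ N : ℕ, N ≠ 0 ∧ N • x = 0 := by
  induction x using DirectSum.induction_on with
  | zero => exact ⟨1, one_ne_zero, smul_zero _⟩
  | of p x =>
    obtain ⟨a, ha⟩ := exists_pow_nsmul_eq_zero_prufer_pi p (n p) x
    exact ⟨(p : ℕ) ^ a, pow_ne_zero _ p.2.ne_zero, by rw [← map_nsmul, ha, map_zero]⟩
  | add x y hx hy =>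
    obtain ⟨M, hM, hx⟩ := hx
    obtain ⟨N, hN, hy⟩ := hy
    refine ⟨M * N, mul_ne_zero hM hN, ?_⟩
    rw [smul_add, mul_smul, mul_smul, smul_comm M N x, hx, hy, smul_zero, smul_zero, add_zero]

theorem isDivisible : IsDivisible (PruferSum n) :=
  IsDivisible.directSum fun p => IsDivisible.pi fun _ =>
    IsDivisible.primaryComponent isDivisible_ratCircle p p.2

/-- A component at `q ≠ p` has order dividing both `p` and a power of `q`, so it is zero. -/
theorem eq_of_prime_nsmul_eq_zero (p : Nat.Primes) (x : PruferSum n) (hx : (p : ℕ) • x = 0) :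
    x = DirectSum.of (fun p => Fin (n p) → Prufer p) p (x p) := by
  refine DFinsupp.ext fun q => ?_
  by_cases hq : q = p
  · subst hq
    exact (DirectSum.of_eq_same (β := fun p => Fin (n p) → Prufer p) q (x q)).symm
  · refine Eq.trans ?_
      (DirectSum.of_eq_of_ne (β := fun p => Fin (n p) → Prufer p) p q (x p) hq).symm
    have h1 : (p : ℕ) • x q = 0 := DFunLike.congr_fun hx q
    obtain ⟨a, ha⟩ := exists_pow_nsmul_eq_zero_prufer_pi q (n q) (x q)
    have hcop : Nat.Coprime (p : ℕ) ((q : ℕ) ^ a) := Nat.Coprime.pow_right _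
      ((Nat.coprime_primes p.2 q.2).mpr fun h => hq (Subtype.ext h.symm))
    have h2 := Nat.dvd_gcd (addOrderOf_dvd_of_nsmul_eq_zero h1)
      (addOrderOf_dvd_of_nsmul_eq_zero ha)
    rw [hcop.gcd_eq_one, Nat.dvd_one] at h2
    exact AddMonoid.addOrderOf_eq_one_iff.mp h2

instance : Countable (PruferSum n) := by
  classical
  have h : ∀ p : Nat.Primes, Countable (Prufer p) := fun p =>
    have : Countable (ℚ ⧸ AddSubgroup.zmultiples (1 : ℚ)) :=
      (QuotientAddGroup.mk'_surjective (AddSubgroup.zmultiples (1 : ℚ))).countable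
    Subtype.countable
  -- An element is determined by the finite graph of its nonzero components, and there are countably
  -- many such graphs.
  let f : PruferSum n → Finset (Σ p : Nat.Primes, Fin (n p) → Prufer p) :=
    fun x => (DFinsupp.support x).image fun p => ⟨p, x p⟩
  have hf : ∀ x (p : Nat.Primes) v, (⟨p, v⟩ : Σ p : Nat.Primes, Fin (n p) → Prufer p) ∈ f x ↔
      x p ≠ 0 ∧ x p = v := by
    intro x p v
    simp only [f, Finset.mem_image, DFinsupp.mem_support_iff, Sigma.mk.injEq]
    constructor
    · rintro ⟨q, hq, rfl, h⟩
      exact ⟨hq, eq_of_heq h⟩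
    · rintro ⟨h, rfl⟩
      exact ⟨p, h, rfl, HEq.rfl⟩
  refine Function.Injective.countable (f := f) fun x y hxy => DFinsupp.ext fun p => ?_
  by_cases hx : x p = 0
  · by_contra hne
    have := (hf y p (y p)).mpr ⟨fun h0 => hne (hx.trans h0.symm), rfl⟩
    rw [← hxy, hf] at this
    exact this.1 hx
  · have := (hf x p (x p)).mpr ⟨hx, rfl⟩
    rw [hxy, hf] at this
    exact this.2.symm

end PruferSum

/-- The `ℚ`-vector space structure on homomorphisms from `ℚ`, by precomposition. -/
abbrev ratHomModule (K : Type*) [AddCommGroup K] : Module ℚ (ℚ →+ K) where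
  smul q f := f.comp (AddMonoidHom.mulLeft q)
  one_smul f := AddMonoidHom.ext fun x => congrArg f (one_mul x)
  mul_smul a b f := AddMonoidHom.ext fun x => congrArg f (by
    change a * b * x = b * (a * x)
    ring)
  smul_zero a := rfl
  smul_add a f g := rfl
  add_smul a b f := AddMonoidHom.ext fun x => (congrArg f (add_mul a b x)).trans (map_add f _ _)
  zero_smul f := AddMonoidHom.ext fun x => (congrArg f (zero_mul x)).trans (map_zero f)

/-- A torsion-free divisible group is isomorphic to the group of homomorphisms from `ℚ` to it. -/
theorem exists_equiv_ratHom {K : Type*} [AddCommGroup K] (hK : IsDivisible K)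
    (htf : ∀ N : ℕ, N ≠ 0 → ∀ x : K, N • x = 0 → x = 0) : Nonempty ((ℚ →+ K) ≃+ K) := by
  refine ⟨AddEquiv.ofBijective
    ({ toFun := fun f => f 1, map_zero' := rfl, map_add' := fun _ _ => rfl } : (ℚ →+ K) →+ K)
    ⟨?_, fun x => ?_⟩⟩
  · rw [injective_iff_map_eq_zero]
    intro f hf
    change f 1 = 0 at hf
    -- Clearing the denominator gives `q.den • f q = q.num • f 1 = 0`.
    refine AddMonoidHom.ext fun q => htf q.den q.den_ne_zero (f q) ?_
    rw [← map_nsmul, nsmul_eq_mul, Rat.den_mul_eq_num, ← mul_one (q.num : ℚ), ← zsmul_eq_mul,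
      map_zsmul, hf, smul_zero]
  · obtain ⟨g, hg⟩ := hK.exists_extension (Int.castAddHom ℚ) Int.cast_injective
      (zmultiplesHom K x)
    refine ⟨g, ?_⟩
    have := hg 1
    simpa using this

/-- A torsion-free divisible group of cardinality continuum is a direct sum of continuum many
copies of `ℚ`. -/
theorem exists_equiv_finsupp_rat {K : Type*} [AddCommGroup K] (hK : IsDivisible K)
    (htf : ∀ N : ℕ, N ≠ 0 → ∀ x : K, N • x = 0 → x = 0) (hcard : #K = 𝔠) :
    Nonempty (K ≃+ ((ℕ → Bool) →₀ ℚ)) := by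
  obtain ⟨e⟩ := exists_equiv_ratHom hK htf
  let _ := ratHomModule K
  let b := Module.Basis.ofVectorSpace ℚ (ℚ →+ K)
  set ι := Module.Basis.ofVectorSpaceIndex ℚ (ℚ →+ K)
  have h1 : #(ι →₀ ℚ) = 𝔠 := by
    rw [← hcard, ← Cardinal.mk_congr e.toEquiv, Cardinal.mk_congr b.repr.toEquiv]
  have hinf : Infinite ι := by
    by_contra hfin
    rw [not_infinite_iff_finite] at hfin
    have hc : Countable (ι →₀ ℚ) := inferInstance
    rw [← Cardinal.mk_le_aleph0_iff, h1] at hc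
    exact (not_le.mpr aleph0_lt_continuum) hc
  -- For infinite `ι` the cardinality of `ι →₀ ℚ` is `max #ι ℵ₀`.
  have h2 : #ι = 𝔠 := by
    rw [mk_finsupp_lift_of_infinite, Cardinal.mkRat, lift_aleph0] at h1
    simp only [lift_uzero] at h1
    rcases max_choice #ι ℵ₀ with h | h
    · rwa [h] at h1
    · rw [h] at h1
      exact absurd h1 aleph0_lt_continuum.ne
  obtain ⟨s⟩ : Nonempty (ι ≃ (ℕ → Bool)) := by
    rw [← Cardinal.lift_mk_eq', h2]
    simp
  exact ⟨e.symm.trans (b.repr.toAddEquiv.trans (Finsupp.domCongr s))⟩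

/-- A divisible group of cardinality continuum whose `p`-socle has order `p ^ (n p)` for all
primes `p` is isomorphic to the model group. -/
theorem exists_equiv_modelGroup {D : Type*} [AddCommGroup D] (hD : IsDivisible D)
    (n : Nat.Primes → ℕ)
    (hn : ∀ p : Nat.Primes, Nat.card {x : D // (p : ℕ) • x = 0} = (p : ℕ) ^ n p)
    (hcard : #D = 𝔠) : Nonempty (D ≃+ ModelGroup n) := by
  choose g hg₁ hg₂ using fun p => exists_hom_from_prufer hD p (n p) (hn p)
  let G : PruferSum n →+ D := DirectSum.toAddMonoid g
  have hG : ∀ p x, G (DirectSum.of (fun p => Fin (n p) → Prufer p) p x) = g p x :=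
    fun p x => DirectSum.toAddMonoid_of g p x
  have hsoc : ∀ p : Nat.Primes, ∀ x : PruferSum n, (p : ℕ) • x = 0 → G x = 0 → x = 0 := by
    intro p x hx hGx
    have hxp := PruferSum.eq_of_prime_nsmul_eq_zero n p x hx
    have h0 : x p = 0 := hg₁ p _ (DFunLike.congr_fun hx p) (by rw [← hG, ← hxp, hGx])
    rw [hxp, h0, map_zero]
  have hinj : Function.Injective G := by
    rw [injective_iff_map_eq_zero]
    intro x hx
    obtain ⟨N, hN, hNx⟩ := PruferSum.exists_nsmul_eq_zero n x
    exact eq_zero_of_socle_injective G (fun p hp => hsoc ⟨p, hp⟩) N hN x hNx hx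
  have htors : ∀ N : ℕ, N ≠ 0 → ∀ y : D, N • y = 0 → ∃ x, G x = y :=
    exists_preimage_of_socle_surjective (PruferSum.isDivisible n) G fun p hp y hy => by
      obtain ⟨x, hx⟩ := hg₂ ⟨p, hp⟩ y hy
      exact ⟨_, (hG ⟨p, hp⟩ x).trans hx⟩
  -- The image of `G` is divisible, hence a direct summand, with complement the kernel of a
  -- retraction `r`. All torsion of `D` lies in the image, so the complement is torsion-free.
  obtain ⟨r, hr⟩ := (PruferSum.isDivisible n).exists_extension G hinj (AddMonoidHom.id _)
  replace hr : ∀ x, r (G x) = x := hr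
  let π : D →+ r.ker := (AddMonoidHom.id D - G.comp r).codRestrict r.ker fun x => by
    rw [AddMonoidHom.mem_ker]
    simp [hr]
  have hπ : ∀ x, (π x : D) = x - G (r x) := fun x => rfl
  have hπk : ∀ x : r.ker, π x = x := fun x => Subtype.ext (by
    rw [hπ, AddMonoidHom.mem_ker.mp x.2, map_zero, sub_zero])
  have hKdiv : IsDivisible r.ker := hD.of_surjective π fun x => ⟨x, hπk x⟩
  have hKtf : ∀ N : ℕ, N ≠ 0 → ∀ x : r.ker, N • x = 0 → x = 0 := by
    intro N hN x hx
    obtain ⟨m, hm⟩ := htors N hN x (congrArg Subtype.val hx)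
    have h0 := x.2
    rw [← hm, AddMonoidHom.mem_ker, hr] at h0
    exact Subtype.ext (by rw [← hm, h0, map_zero]; rfl)
  let e : D ≃+ r.ker × PruferSum n :=
    { toFun := fun x => (π x, r x)
      invFun := fun y => y.1 + G y.2
      left_inv := fun x => by
        change (π x : D) + G (r x) = x
        rw [hπ, sub_add_cancel]
      right_inv := fun y => by
        have h1 : r (y.1 + G y.2) = y.2 := by
          rw [map_add, AddMonoidHom.mem_ker.mp y.1.2, hr, zero_add]
        refine Prod.ext (Subtype.ext ?_) h1
        change (π (y.1 + G y.2) : D) = y.1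
        rw [hπ, h1, add_sub_cancel_right]
      map_add' := fun x y => by rw [map_add, map_add]; rfl }
  have hKcard : #r.ker = 𝔠 := by
    refine le_antisymm (hcard ▸ Cardinal.mk_subtype_le _) (not_lt.mp fun hlt => ?_)
    -- The Prüfer part is countable, so a smaller complement would make `D` too small.
    have h : #D < 𝔠 := by
      rw [Cardinal.mk_congr e.toEquiv, Cardinal.mk_prod]
      refine mul_lt_of_lt aleph0_le_continuum ?_ ?_
      · simpa using hlt
      · refine lt_of_le_of_lt ?_ aleph0_lt_continuum
        rw [Cardinal.lift_le_aleph0]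
        exact Cardinal.mk_le_aleph0
    exact h.ne hcard
  obtain ⟨s⟩ := exists_equiv_finsupp_rat hKdiv hKtf hKcard
  exact ⟨e.trans (s.prodCongr (AddEquiv.refl _))⟩

end DivisibleGroups

/-! ### Torsion-free groups of finite rank and their coranks -/

section TorsionFreeFiniteRank

variable {Λ : Type*} [AddCommGroup Λ] {d : ℕ}

/-- A group of rank `d` contains `d` independent elements whose span has torsion quotient. -/
theorem exists_linearIndependent_of_rank_eq (hr : Module.rank ℤ Λ = d) :
    ∃ b : Fin d → Λ, LinearIndependent ℤ b ∧
      ∀ x : Λ, ∃ a : ℤ, a ≠ 0 ∧ a • x ∈ Submodule.span ℤ (Set.range b) := by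
  obtain ⟨s, hs, hli⟩ := exists_set_linearIndependent ℤ Λ
  rw [hr] at hs
  obtain ⟨e⟩ : Nonempty (Fin d ≃ s) := by
    rw [← Cardinal.lift_mk_eq', hs]
    simp
  have hrange : Set.range (fun i => (e i : Λ)) = s := by
    change Set.range (Subtype.val ∘ e) = s
    rw [e.surjective.range_comp, Subtype.range_coe]
  refine ⟨fun i => e i, hli.comp e e.injective, fun x => ?_⟩
  rw [hrange]
  have h := Submodule.rank_quotient_add_rank (Submodule.span ℤ s)
  rw [rank_span_set hli, hs, hr] at h
  -- Rank is additive, so the quotient by a maximal independent family has rank zero, that is, it is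
  -- torsion.
  have h0 : Module.rank ℤ (Λ ⧸ Submodule.span ℤ s) = 0 := by
    refine Cardinal.eq_of_add_eq_add_right (b := (d : Cardinal)) ?_ (Cardinal.natCast_lt_aleph0)
    rw [h, zero_add]
  obtain ⟨a, ha, hax⟩ := rank_eq_zero_iff.mp h0 (Submodule.Quotient.mk x)
  exact ⟨a, ha, (Submodule.Quotient.mk_eq_zero _).mp hax⟩

/-- A homomorphism to `ℚ` is determined by its values on `d` independent elements, as their span has
torsion quotient. -/
theorem countable_ratHom_of_rank_eq (hr : Module.rank ℤ Λ = d) : Countable (Λ →+ ℚ) := by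
  obtain ⟨b, -, hb⟩ := exists_linearIndependent_of_rank_eq hr
  refine Function.Injective.countable (f := fun (g : Λ →+ ℚ) (i : Fin d) => g (b i)) ?_
  intro f g hfg
  refine AddMonoidHom.ext fun x => ?_
  obtain ⟨a, ha, hx⟩ := hb x
  have h : Set.EqOn f.toIntLinearMap g.toIntLinearMap (Submodule.span ℤ (Set.range b)) := by
    refine LinearMap.eqOn_span ?_
    rintro _ ⟨i, rfl⟩
    exact congrFun hfg i
  have h1 : f (a • x) = g (a • x) := h hx
  rw [map_zsmul, map_zsmul] at h1
  exact smul_right_injective ℚ ha h1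

/-- A linearly independent family of `Λ / pΛ` lifts to one of `Λ`. -/
theorem linearIndependent_of_mod_prime [IsAddTorsionFree Λ] (p : ℕ) [Fact p.Prime] {ι : Type*}
    [Fintype ι] (v : ι → Λ) (hv : LinearIndependent (ZMod p) fun i => ModN.mkQ p (v i)) :
    LinearIndependent ℤ v := by
  have hp : p.Prime := Fact.out
  rw [Fintype.linearIndependent_iff] at hv ⊢
  -- Descent: independence modulo `p` makes every coefficient of a relation divisible by `p`, and
  -- torsion-freeness lets `p` be cancelled to give a new relation.
  have key : ∀ (k : ℕ) (g : ι → ℤ), ∑ i, g i • v i = 0 → ∀ i, (p : ℤ) ^ k ∣ g i := by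
    intro k
    induction k with
    | zero => intro g _ i; simp
    | succ k ih =>
      intro g hg
      have h1 : ∑ i, (g i : ZMod p) • ModN.mkQ p (v i) = 0 := by
        have := congrArg (ModN.mkQ p) hg
        rw [map_sum, map_zero] at this
        rw [← this]
        exact Finset.sum_congr rfl fun i _ => by rw [map_zsmul, Int.cast_smul_eq_zsmul]
      choose c hc using fun i => (ZMod.intCast_zmod_eq_zero_iff_dvd (g i) p).mp (hv _ h1 i)
      have h2 : ∑ i, c i • v i = 0 := by
        have : (p : ℤ) • ∑ i, c i • v i = 0 := by
          rw [Finset.smul_sum, ← hg]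
          exact Finset.sum_congr rfl fun i _ => by rw [smul_smul, ← hc]
        exact (smul_eq_zero.mp this).resolve_left (Nat.cast_ne_zero.mpr hp.ne_zero)
      intro i
      rw [hc i, pow_succ']
      exact mul_dvd_mul_left _ (ih c h2 i)
  intro g hg i
  refine Int.eq_zero_of_dvd_of_natAbs_lt_natAbs (key (g i).natAbs g hg i) ?_
  rw [Int.natAbs_pow, Int.natAbs_natCast]
  exact Nat.lt_pow_self hp.one_lt

theorem rank_modN_le [IsAddTorsionFree Λ] (p : ℕ) [Fact p.Prime] (hr : Module.rank ℤ Λ = d) :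
    Module.rank (ZMod p) (ModN Λ p) ≤ d := by
  refine rank_le fun s hs => ?_
  choose v hv using fun i : s => Submodule.Quotient.mk_surjective _ (i : ModN Λ p)
  have h : LinearIndependent ℤ v := by
    refine linearIndependent_of_mod_prime p v ?_
    have : (fun i => ModN.mkQ p (v i)) = fun i : s => (i : ModN Λ p) := funext hv
    rw [this]
    exact hs
  have h2 := h.cardinal_lift_le_rank
  rw [hr] at h2
  simpa using h2

theorem finite_modN [IsAddTorsionFree Λ] (p : ℕ) [Fact p.Prime] (hr : Module.rank ℤ Λ = d) :
    Module.Finite (ZMod p) (ModN Λ p) :=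
  Module.rank_lt_aleph0_iff.mp ((rank_modN_le p hr).trans_lt Cardinal.natCast_lt_aleph0)

theorem pCorank_le [IsAddTorsionFree Λ] (p : Nat.Primes) (hr : Module.rank ℤ Λ = d) :
    pCorank p Λ ≤ d := by
  have : Fact (p : ℕ).Prime := ⟨p.2⟩
  exact Module.finrank_le_of_rank_le (rank_modN_le (p : ℕ) hr)

theorem pIndex_eq_natCard_modN (p : ℕ) : pIndex p Λ = Nat.card (ModN Λ p) := by
  have h : (nsmulAddMonoidHom (α := Λ) p).range =
      (LinearMap.range (LinearMap.lsmul ℤ Λ p)).toAddSubgroup := by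
    ext x
    simp
  rw [pIndex, h]
  rfl

theorem pIndex_congr {Λ' : Type*} [AddCommGroup Λ'] (e : Λ ≃+ Λ') (p : ℕ) :
    pIndex p Λ = pIndex p Λ' := by
  refine Nat.card_congr (QuotientAddGroup.congr _ _ e ?_).toEquiv
  ext y
  constructor
  · rintro ⟨_, ⟨x, rfl⟩, rfl⟩
    exact ⟨e x, (map_nsmul e p x).symm⟩
  · rintro ⟨x, rfl⟩
    refine ⟨p • e.symm x, ⟨e.symm x, rfl⟩, ?_⟩
    change e (p • e.symm x) = p • x
    rw [map_nsmul, e.apply_symm_apply]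

theorem pIndex_eq_pow [IsAddTorsionFree Λ] (p : Nat.Primes) (hr : Module.rank ℤ Λ = d) :
    pIndex p Λ = (p : ℕ) ^ pCorank p Λ := by
  have : Fact (p : ℕ).Prime := ⟨p.2⟩
  have := finite_modN (p : ℕ) hr
  rw [pIndex_eq_natCard_modN, Module.natCard_eq_pow_finrank (K := ZMod p), Nat.card_zmod]
  rfl

/-- Homomorphisms from `Λ` to the elements of `A` killed by `p` are as numerous as `n`-tuples of
such elements, where `n` is the `p`-corank of `Λ`. -/
theorem card_hom_torsion [IsAddTorsionFree Λ] (p : Nat.Primes) (hr : Module.rank ℤ Λ = d)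
    (A : Type*) [AddCommGroup A] :
    Nat.card {φ : Λ →+ A // ∀ g, (p : ℕ) • φ g = 0} =
      Nat.card {x : A // (p : ℕ) • x = 0} ^ pCorank p Λ := by
  have : Fact (p : ℕ).Prime := ⟨p.2⟩
  have := finite_modN (p : ℕ) hr
  let T := AddSubgroup.torsionBy A ((p : ℕ) : ℤ)
  let _ : Module (ZMod p) T := AddSubgroup.torsionBy.zmodModule
  let e₁ : {φ : Λ →+ A // ∀ g, (p : ℕ) • φ g = 0} ≃ {φ : Λ →+ T // ∀ g, (p : ℕ) • φ g = 0} :=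
    { toFun := fun φ => ⟨φ.1.codRestrict T fun x => AddSubgroup.torsionBy.nsmul_iff.mpr (φ.2 x),
        fun g => Subtype.ext (φ.2 g)⟩
      invFun := fun φ => ⟨T.subtype.comp φ.1, fun g => congrArg Subtype.val (φ.2 g)⟩
      left_inv := fun _ => rfl
      right_inv := fun _ => rfl }
  let b := Module.finBasis (ZMod p) (ModN Λ p)
  -- Homomorphisms into a group killed by `p` factor through `Λ/pΛ`, where they are given by
  -- arbitrary values on a basis.
  have e : {φ : Λ →+ A // ∀ g, (p : ℕ) • φ g = 0} ≃ (Fin (pCorank p Λ) → T) :=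
    e₁.trans (ModN.liftEquiv'.symm.trans (b.constr ℕ).toEquiv.symm)
  rw [Nat.card_congr e, Nat.card_fun, Nat.card_fin]
  congr 1
  exact Nat.card_congr (Equiv.subtypeEquivRight fun x => AddSubgroup.torsionBy.nsmul_iff)

/-- Encode `x` by a nonzero multiplier `a` and integer coordinates of `a • x`; torsion-freeness
makes this injective. -/
theorem countable_of_rank_eq [IsAddTorsionFree Λ] (hr : Module.rank ℤ Λ = d) : Countable Λ := by
  obtain ⟨b, -, hb⟩ := exists_linearIndependent_of_rank_eq hr
  choose a ha h using hb
  choose c hc using fun x => (Submodule.mem_span_range_iff_exists_fun ℤ).mp (h x)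
  refine Function.Injective.countable (f := fun x => (a x, c x)) fun x y hxy => ?_
  simp only [Prod.mk.injEq] at hxy
  refine smul_right_injective Λ (ha x) ?_
  change a x • x = a x • y
  rw [← hc x, hxy.1, hxy.2, hc y]

end TorsionFreeFiniteRank

/-! ### Consequences of having no free summand -/

section NoFreeSummand

variable {Λ : Type*} [AddCommGroup Λ]

/-- The image of `f` is a subgroup of `ℤ`, hence free, so `f` splits over its image and the image
becomes a free summand of `Λ`. -/
theorem NoFreeSummand.intHom_eq_zero (h : NoFreeSummand Λ) (f : Λ →+ ℤ) : f = 0 := by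
  let g := f.toIntLinearMap
  obtain ⟨s, hs⟩ := Module.projective_lifting_property g.rangeRestrict LinearMap.id
    g.surjective_rangeRestrict
  have hs' : ∀ y, g.rangeRestrict (s y) = y := fun y => LinearMap.congr_fun hs y
  have hinj : Function.Injective s := Function.LeftInverse.injective hs'
  have hcompl : IsCompl (LinearMap.range s) (LinearMap.ker g) := by
    constructor
    · rw [Submodule.disjoint_def]
      rintro _ ⟨y, rfl⟩ hy
      have : g.rangeRestrict (s y) = 0 := Subtype.ext hy
      rw [hs'] at this
      rw [this, map_zero]
    · rw [codisjoint_iff, eq_top_iff]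
      intro x _
      rw [Submodule.mem_sup]
      refine ⟨s (g.rangeRestrict x), ⟨_, rfl⟩, x - s (g.rangeRestrict x), ?_, by abel⟩
      have := congrArg Subtype.val (hs' (g.rangeRestrict x))
      change g (s (g.rangeRestrict x)) = g x at this
      rw [LinearMap.mem_ker, map_sub, this, sub_self]
  have hbot := h _ _ hcompl (Module.Free.of_equiv (LinearEquiv.ofInjective s hinj))
  refine AddMonoidHom.ext fun x => ?_
  have h1 : s (g.rangeRestrict x) = 0 := LinearMap.congr_fun (LinearMap.range_eq_bot.mp hbot) _
  have h2 : g.rangeRestrict x = 0 := hinj (h1.trans (map_zero s).symm)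
  exact congrArg Subtype.val h2

/-- A finitely generated torsion-free group is free, and would be a free summand of itself. -/
theorem NoFreeSummand.not_fg [IsAddTorsionFree Λ] [Nontrivial Λ] (h : NoFreeSummand Λ) :
    ¬ AddGroup.FG Λ := by
  intro hfg
  have : Module.Finite ℤ Λ := Module.Finite.iff_addGroup_fg.mpr hfg
  have := h ⊤ ⊥ isCompl_top_bot (Module.Free.of_equiv Submodule.topEquiv.symm)
  exact top_ne_bot this

end NoFreeSummand

/-! ### The cokernel of Hom(Λ, ℚ) → Hom(Λ, ℚ/ℤ) -/

section CharQuotient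

open Cardinal

/-- The homomorphism `Hom(Λ, ℚ) → Hom(Λ, ℚ / ℤ)`. -/
def ratToChar (Λ : Type*) [AddCommGroup Λ] : (Λ →+ ℚ) →+ (Λ →+ AddCircle (1 : ℚ)) :=
  AddMonoidHom.compHom (QuotientAddGroup.mk' (AddSubgroup.zmultiples (1 : ℚ)))

/-- The cokernel of `Hom(Λ, ℚ) → Hom(Λ, ℚ / ℤ)`, which is isomorphic to `Ext(Λ, ℤ)`. -/
abbrev CharQuotient (Λ : Type*) [AddCommGroup Λ] : Type _ :=
  (Λ →+ AddCircle (1 : ℚ)) ⧸ (ratToChar Λ).range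

variable {Λ : Type*} [AddCommGroup Λ] {d : ℕ}

theorem ratToChar_apply (g : Λ →+ ℚ) (x : Λ) : ratToChar Λ g x = (g x : AddCircle (1 : ℚ)) := rfl

theorem ratCircle_coe_eq_zero_iff (q : ℚ) :
    (q : AddCircle (1 : ℚ)) = 0 ↔ ∃ k : ℤ, q = k := by
  rw [AddCircle.coe_eq_zero_iff]
  simp [eq_comm]

/-- Multiplication by `n` is injective on `Λ`, so a character extends along it; the extension is an
`n`-th part. -/
theorem isDivisible_charHom [IsAddTorsionFree Λ] : IsDivisible (Λ →+ AddCircle (1 : ℚ)) := by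
  intro n hn φ
  obtain ⟨ψ, hψ⟩ := isDivisible_ratCircle.exists_extension (nsmulAddMonoidHom (α := Λ) n)
    (IsAddTorsionFree.nsmul_right_injective hn) φ
  refine ⟨ψ, AddMonoidHom.ext fun x => ?_⟩
  rw [← hψ x]
  exact (map_nsmul ψ n x).symm

theorem isDivisible_charQuotient [IsAddTorsionFree Λ] : IsDivisible (CharQuotient Λ) :=
  isDivisible_charHom.of_surjective (QuotientAddGroup.mk' _) (QuotientAddGroup.mk'_surjective _)

/-- If `Λ` has no free summand, then a homomorphism to `ℚ` with integral values is zero. -/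
theorem NoFreeSummand.eq_zero_of_integral (h : NoFreeSummand Λ) (f : Λ →+ ℚ)
    (hf : ∀ x, ∃ k : ℤ, f x = k) : f = 0 := by
  choose k hk using hf
  let g : Λ →+ ℤ :=
    { toFun := k
      map_zero' := by
        have := hk 0
        rw [map_zero] at this
        exact_mod_cast this.symm
      map_add' := fun x y => by
        have := hk (x + y)
        rw [map_add, hk x, hk y] at this
        exact_mod_cast this.symm }
  have hg := h.intHom_eq_zero g
  refine AddMonoidHom.ext fun x => ?_
  have : k x = 0 := DFunLike.congr_fun hg x
  rw [hk x, this]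
  simp

/-- Characters killed by `p` map bijectively onto the `p`-torsion of the cokernel: injectively
because `Hom(Λ, ℤ) = 0`, surjectively because `ℚ` allows division by `p`. -/
theorem card_charQuotient_torsion [IsAddTorsionFree Λ] (h : NoFreeSummand Λ) (p : Nat.Primes)
    (hr : Module.rank ℤ Λ = d) :
    Nat.card {x : CharQuotient Λ // (p : ℕ) • x = 0} = (p : ℕ) ^ pCorank p Λ := by
  have hp : ((p : ℕ) : ℚ) ≠ 0 := Nat.cast_ne_zero.mpr p.2.ne_zero
  have key := card_hom_torsion p hr (AddCircle (1 : ℚ))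
  rw [card_ratCircle_torsion (p : ℕ) p.2.ne_zero] at key
  rw [← key]
  symm
  let F : {φ : Λ →+ AddCircle (1 : ℚ) // ∀ g, (p : ℕ) • φ g = 0} →
      {x : CharQuotient Λ // (p : ℕ) • x = 0} := fun φ =>
    ⟨QuotientAddGroup.mk φ.1, by
      rw [← QuotientAddGroup.mk_nsmul]
      have : (p : ℕ) • φ.1 = 0 := AddMonoidHom.ext φ.2
      rw [this, QuotientAddGroup.mk_zero]⟩
  refine Nat.card_congr (Equiv.ofBijective F ⟨?_, ?_⟩)
  · rintro ⟨φ, hφ⟩ ⟨ψ, hψ⟩ hF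
    have hF' : (QuotientAddGroup.mk φ : CharQuotient Λ) = QuotientAddGroup.mk ψ :=
      congrArg Subtype.val hF
    rw [QuotientAddGroup.eq] at hF'
    obtain ⟨g, hg⟩ := hF'
    have hz : (p : ℕ) • g = 0 := by
      refine h.eq_zero_of_integral _ fun x => ?_
      rw [← ratCircle_coe_eq_zero_iff]
      have h1 := DFunLike.congr_fun hg x
      rw [ratToChar_apply] at h1
      change (((p : ℕ) • g x : ℚ) : AddCircle (1 : ℚ)) = 0
      rw [AddCircle.coe_nsmul, h1]
      change (p : ℕ) • (-φ x + ψ x) = 0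
      rw [smul_add, smul_neg, hφ, hψ, neg_zero, add_zero]
    have hg0 : g = 0 := by
      refine AddMonoidHom.ext fun x => ?_
      have h1 : (p : ℕ) • g x = 0 := DFunLike.congr_fun hz x
      rw [nsmul_eq_mul] at h1
      exact (mul_eq_zero.mp h1).resolve_left hp
    rw [hg0, map_zero] at hg
    exact Subtype.ext (neg_add_eq_zero.mp hg.symm)
  · rintro ⟨x, hx⟩
    induction x using QuotientAddGroup.induction_on with
    | H φ =>
      rw [← QuotientAddGroup.mk_nsmul, QuotientAddGroup.eq_zero_iff] at hx
      obtain ⟨g, hg⟩ := hx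
      -- As `p • φ` lifts to `g`, subtracting the reduction of `g / p` makes `φ` itself killed by
      -- `p` without changing its class.
      let g' : Λ →+ ℚ := (AddMonoidHom.mulLeft ((p : ℕ) : ℚ)⁻¹).comp g
      refine ⟨⟨φ - ratToChar Λ g', fun x => ?_⟩, Subtype.ext ?_⟩
      · have h1 := DFunLike.congr_fun hg x
        rw [ratToChar_apply] at h1
        change (p : ℕ) • (φ x - ratToChar Λ g' x) = 0
        rw [smul_sub, ratToChar_apply, ← AddCircle.coe_nsmul]
        have h2 : (p : ℕ) • g' x = g x := by
          change (p : ℕ) • (((p : ℕ) : ℚ)⁻¹ * g x) = g x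
          rw [nsmul_eq_mul, mul_inv_cancel_left₀ hp]
        rw [h2, h1]
        exact sub_self _
      · change (QuotientAddGroup.mk (φ - ratToChar Λ g') : CharQuotient Λ) = QuotientAddGroup.mk φ
        rw [QuotientAddGroup.eq]
        exact ⟨g', by abel⟩

/-- A countable group that is not finitely generated carries a locally finite triangular
sequence of characters. -/
theorem exists_triangular_characters [Countable Λ] (hfg : ¬ AddGroup.FG Λ) :
    ∃ (ψ : ℕ → Λ →+ AddCircle (1 : ℚ)) (t : ℕ → Λ), (∀ k, ψ k (t k) ≠ 0) ∧
      (∀ j k, j < k → ψ k (t j) = 0) ∧ ∀ x, ∃ N, ∀ k, N ≤ k → ψ k x = 0 := by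
  classical
  obtain ⟨l, hl⟩ := exists_surjective_nat Λ
  let H : ℕ → AddSubgroup Λ := fun n => AddSubgroup.closure (l '' Set.Iio n)
  have hmem : ∀ j n, j < n → l j ∈ H n := fun j n hj =>
    AddSubgroup.subset_closure ⟨j, hj, rfl⟩
  -- Indices whose element is not generated by its predecessors; were there finitely many, `Λ` would
  -- be finitely generated.
  let S : Set ℕ := {n | l n ∉ H n}
  have hS : S.Infinite := by
    intro hfin
    obtain ⟨N, hN⟩ := hfin.bddAbove
    apply hfg
    have hall : ∀ n, l n ∈ H (N + 1) := by
      intro n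
      induction n using Nat.strong_induction_on with
      | _ n ih =>
        rcases Nat.lt_or_ge n (N + 1) with h | h
        · exact hmem n _ h
        · have h1 : l n ∈ H n := by
            by_contra hn
            have := hN (show n ∈ S from hn)
            omega
          refine (AddSubgroup.closure_le _).mpr ?_ h1
          rintro _ ⟨j, hj, rfl⟩
          exact ih j hj
    refine ⟨⟨((Set.finite_Iio (N + 1)).image l).toFinset, ?_⟩⟩
    rw [Set.Finite.coe_toFinset, eq_top_iff]
    intro x _
    obtain ⟨n, rfl⟩ := hl x
    exact hall n
  have hφ : ∀ n ∈ S, ∃ φ : Λ →+ AddCircle (1 : ℚ), (∀ x ∈ H n, φ x = 0) ∧ φ (l n) ≠ 0 := by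
    intro n hn
    have h0 : (QuotientAddGroup.mk (l n) : Λ ⧸ H n) ≠ 0 := fun h =>
      hn ((QuotientAddGroup.eq_zero_iff _).mp h)
    obtain ⟨c, hc⟩ := CharacterModule.exists_character_apply_ne_zero_of_ne_zero h0
    let c' : Λ ⧸ H n →+ AddCircle (1 : ℚ) := c
    refine ⟨c'.comp (QuotientAddGroup.mk' (H n)), fun x hx => ?_, hc⟩
    change c' (QuotientAddGroup.mk x) = 0
    rw [(QuotientAddGroup.eq_zero_iff x).mpr hx, map_zero]
  choose! φ hφ₁ hφ₂ using hφ
  have := hS.to_subtype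
  let e : ℕ ↪o ℕ := Nat.orderEmbeddingOfSet S
  have he : ∀ k, e k ∈ S := fun k => by
    rw [← Nat.orderEmbeddingOfSet_range S]
    exact ⟨k, rfl⟩
  refine ⟨fun k => φ (e k), fun k => l (e k), fun k => hφ₂ _ (he k), fun j k hjk => ?_,
    fun x => ?_⟩
  · exact hφ₁ _ (he k) _ (hmem _ _ (e.lt_iff_lt.mpr hjk))
  · obtain ⟨n, rfl⟩ := hl x
    -- Since `e k ≥ k > n`, the element `l n` is among the generators of `H (e k)`.
    exact ⟨n + 1, fun k hk => hφ₁ _ (he k) _ (hmem _ _ (by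
      have := e.strictMono.id_le k
      simp only [id] at this
      omega))⟩

/-- Send a bit sequence `b` to the pointwise finite sum of the `ψ k` with `b k` true. By
triangularity, the value at `t k` and the earlier bits determine `b k`. -/
theorem exists_injective_characters [Countable Λ] (hfg : ¬ AddGroup.FG Λ) :
    ∃ F : (ℕ → Bool) → (Λ →+ AddCircle (1 : ℚ)), Function.Injective F := by
  obtain ⟨ψ, t, h₁, h₂, h₃⟩ := exists_triangular_characters hfg
  choose N hN using h₃
  let term : (ℕ → Bool) → Λ → ℕ → AddCircle (1 : ℚ) := fun b x k => if b k then ψ k x else 0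
  have hterm : ∀ b x k, N x ≤ k → term b x k = 0 := fun b x k hk => by
    simp [term, hN x k hk]
  have hstab : ∀ b x M, N x ≤ M →
      ∑ k ∈ Finset.range (N x), term b x k = ∑ k ∈ Finset.range M, term b x k := by
    intro b x M hM
    refine Finset.sum_subset (Finset.range_mono hM) fun k _ hk => hterm b x k ?_
    simpa using hk
  let F : (ℕ → Bool) → (Λ →+ AddCircle (1 : ℚ)) := fun b =>
    AddMonoidHom.mk' (fun x => ∑ k ∈ Finset.range (N x), term b x k) fun x y => by
      let M := max (N (x + y)) (max (N x) (N y))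
      rw [hstab b _ M (le_max_left _ _),
        hstab b x M ((le_max_left _ _).trans (le_max_right _ _)),
        hstab b y M ((le_max_right _ _).trans (le_max_right _ _)), ← Finset.sum_add_distrib]
      refine Finset.sum_congr rfl fun k _ => ?_
      simp only [term]
      split_ifs
      · exact map_add _ _ _
      · exact (add_zero _).symm
  have hF : ∀ b k, F b (t k) = ∑ j ∈ Finset.range (k + 1), term b (t k) j := by
    intro b k
    let M := max (N (t k)) (k + 1)
    change ∑ j ∈ Finset.range (N (t k)), term b (t k) j = _
    rw [hstab b _ M (le_max_left _ _)]
    symm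
    refine Finset.sum_subset (Finset.range_mono (le_max_right _ _)) fun j _ hj => ?_
    have hj' : k < j := by simpa [Nat.lt_succ_iff] using hj
    simp [term, h₂ k j hj']
  refine ⟨F, fun b c hbc => funext fun k => ?_⟩
  induction k using Nat.strong_induction_on with
  | _ k ih =>
    have h := DFunLike.congr_fun hbc (t k)
    rw [hF, hF, Finset.sum_range_succ, Finset.sum_range_succ] at h
    have heq : ∑ j ∈ Finset.range k, term b (t k) j = ∑ j ∈ Finset.range k, term c (t k) j :=
      Finset.sum_congr rfl fun j hj => by
        simp only [term]
        rw [ih j (Finset.mem_range.mp hj)]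
    rw [heq] at h
    have h' := add_left_cancel h
    have hk := h₁ k
    simp only [term] at h'
    cases hb : b k <;> cases hc : c k <;> simp_all

/-- There are at most `ℵ₀ ^ ℵ₀ = 𝔠` characters and at least `2 ^ ℵ₀`; dividing by a countable
subgroup cannot lower this. -/
theorem mk_charQuotient {Λ : Type*} [AddCommGroup Λ] [Countable Λ] [Countable (Λ →+ ℚ)]
    (hfg : ¬ AddGroup.FG Λ) : #(CharQuotient Λ) = 𝔠 := by
  have hcount : Countable (AddCircle (1 : ℚ)) :=
    (QuotientAddGroup.mk'_surjective (AddSubgroup.zmultiples (1 : ℚ))).countable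
  have hle : #(Λ →+ AddCircle (1 : ℚ)) ≤ 𝔠 := by
    refine (Cardinal.mk_le_of_injective
      (DFunLike.coe_injective (F := Λ →+ AddCircle (1 : ℚ)))).trans ?_
    rw [Cardinal.mk_arrow]
    calc lift #(AddCircle (1 : ℚ)) ^ lift #Λ ≤ ℵ₀ ^ lift #Λ := by
          refine Cardinal.power_le_power_right ?_
          rw [Cardinal.lift_le_aleph0]
          exact Cardinal.mk_le_aleph0
      _ ≤ ℵ₀ ^ ℵ₀ := by
          refine Cardinal.power_le_power_left aleph0_ne_zero ?_
          rw [Cardinal.lift_le_aleph0]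
          exact Cardinal.mk_le_aleph0
      _ = 𝔠 := aleph0_power_aleph0
  have hge : 𝔠 ≤ #(Λ →+ AddCircle (1 : ℚ)) := by
    obtain ⟨F, hF⟩ := exists_injective_characters hfg
    have := Cardinal.lift_mk_le_lift_mk_of_injective hF
    simpa using this
  refine le_antisymm ((Cardinal.mk_le_of_surjective (QuotientAddGroup.mk'_surjective _)).trans hle)
    (not_lt.mp fun hlt => ?_)
  have h : #(Λ →+ AddCircle (1 : ℚ)) < 𝔠 := by
    rw [Cardinal.mk_congr (AddSubgroup.addGroupEquivQuotientProdAddSubgroup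
      (s := (ratToChar Λ).range)), Cardinal.mk_prod, Cardinal.lift_id, Cardinal.lift_id]
    refine mul_lt_of_lt aleph0_le_continuum hlt (lt_of_le_of_lt ?_ aleph0_lt_continuum)
    have : Countable (ratToChar Λ).range :=
      (ratToChar Λ).rangeRestrict_surjective.countable
    exact Cardinal.mk_le_aleph0
  exact (h.trans_le hge).false

/-- The cokernel of `Hom(Λ, ℚ) → Hom(Λ, ℚ / ℤ)` is determined by the coranks of `Λ`. -/
theorem exists_charQuotient_equiv_modelGroup [IsAddTorsionFree Λ] (hd : 1 ≤ d)
    (hr : Module.rank ℤ Λ = d) (h : NoFreeSummand Λ) :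
    Nonempty (CharQuotient Λ ≃+ ModelGroup (fun p => pCorank p Λ)) := by
  have := countable_of_rank_eq hr
  have := countable_ratHom_of_rank_eq hr
  have : Nontrivial Λ := by
    by_contra hn
    rw [not_nontrivial_iff_subsingleton] at hn
    rw [rank_subsingleton'] at hr
    have : d = 0 := by exact_mod_cast hr.symm
    omega
  exact exists_equiv_modelGroup isDivisible_charQuotient _
    (fun p => card_charQuotient_torsion h p hr) (mk_charQuotient h.not_fg)

end CharQuotient

/-! ### Ext(Λ, ℤ) as a cokernel of character groups -/

section Extensions

/-- The extension of `B` by `F` attached to a cocycle `c`: the set `B × F` with addition twisted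
by `c`. -/
def CocycleExtension {B F : Type*} [AddCommGroup B] [AddCommGroup F]
    (_c : ExtGroup.cocycles B F) : Type _ := B × F

namespace CocycleExtension

variable {B F : Type*} [AddCommGroup B] [AddCommGroup F] (c : ExtGroup.cocycles B F)

instance : Add (CocycleExtension c) := ⟨fun u v => (u.1 + v.1, u.2 + v.2 + c.1 u.1 v.1)⟩

instance : Zero (CocycleExtension c) := ⟨((0, 0) : B × F)⟩

instance : Neg (CocycleExtension c) := ⟨fun u => (-u.1, -u.2 - c.1 (-u.1) u.1)⟩

instance : AddCommGroup (CocycleExtension c) where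
  add_assoc u v w := by
    refine Prod.ext (add_assoc u.1 v.1 w.1) ?_
    change u.2 + v.2 + c.1 u.1 v.1 + w.2 + c.1 (u.1 + v.1) w.1 =
      u.2 + (v.2 + w.2 + c.1 v.1 w.1) + c.1 u.1 (v.1 + w.1)
    have h := c.2.2.1 u.1 v.1 w.1
    calc u.2 + v.2 + c.1 u.1 v.1 + w.2 + c.1 (u.1 + v.1) w.1
        = u.2 + v.2 + w.2 + (c.1 u.1 v.1 + c.1 (u.1 + v.1) w.1) := by abel
      _ = _ := by rw [h]; abel
  zero_add u := by
    refine Prod.ext (zero_add u.1) ?_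
    change 0 + u.2 + c.1 0 u.1 = u.2
    rw [(c.2.1 u.1).2, zero_add, add_zero]
  add_zero u := by
    refine Prod.ext (add_zero u.1) ?_
    change u.2 + 0 + c.1 u.1 0 = u.2
    rw [(c.2.1 u.1).1, add_zero, add_zero]
  nsmul := nsmulRec
  zsmul := zsmulRec
  neg_add_cancel u := by
    refine Prod.ext (neg_add_cancel u.1) ?_
    change -u.2 - c.1 (-u.1) u.1 + u.2 + c.1 (-u.1) u.1 = 0
    abel
  add_comm u v := by
    refine Prod.ext (add_comm u.1 v.1) ?_
    change u.2 + v.2 + c.1 u.1 v.1 = v.2 + u.2 + c.1 v.1 u.1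
    rw [c.2.2.2 u.1 v.1, add_comm u.2]

end CocycleExtension

/-- Every cocycle with values in a divisible group is a coboundary. -/
theorem ExtGroup.exists_eq_coboundary {B F : Type*} [AddCommGroup B] [AddCommGroup F]
    (hF : IsDivisible F) (c : ExtGroup.cocycles B F) :
    ∃ h : B → F, ∀ x y, c.1 x y = h x + h y - h (x + y) := by
  let i : F →+ CocycleExtension c := AddMonoidHom.mk' (fun a => ((0, a) : B × F)) fun a b => by
    refine Prod.ext (add_zero (0 : B)).symm ?_
    change a + b = a + b + c.1 0 0
    rw [(c.2.1 0).1, add_zero]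
  have hi : Function.Injective i := fun a b h => congrArg Prod.snd h
  -- The extension splits because `F` is injective; the retraction applied to the section `x ↦ (x,
  -- 0)` is the required cochain.
  obtain ⟨r, hr⟩ := hF.exists_extension i hi (AddMonoidHom.id F)
  let s : B → CocycleExtension c := fun x => ((x, 0) : B × F)
  have hs : ∀ x y, s x + s y = s (x + y) + i (c.1 x y) := by
    intro x y
    refine Prod.ext (add_zero (x + y)).symm ?_
    change 0 + 0 + c.1 x y = 0 + c.1 x y + c.1 (x + y) 0
    rw [(c.2.1 (x + y)).1, add_zero, add_zero]
  refine ⟨fun x => r (s x), fun x y => ?_⟩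
  have h := congrArg r (hs x y)
  rw [map_add, map_add, hr] at h
  rw [h]
  change c.1 x y = r (s (x + y)) + c.1 x y - r (s (x + y))
  abel

variable (Λ : Type*) [AddCommGroup Λ]

/-- The functions `h : Λ → ℚ` with `h 0 = 0` that are additive modulo `ℤ`. -/
def quasiHoms : AddSubgroup (Λ → ℚ) where
  carrier := {h | h 0 = 0 ∧ ∀ x y, ∃ k : ℤ, h x + h y - h (x + y) = k}
  zero_mem' := ⟨rfl, fun x y => ⟨0, by simp⟩⟩
  add_mem' := by
    rintro a b ⟨ha₀, ha⟩ ⟨hb₀, hb⟩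
    refine ⟨by simp [ha₀, hb₀], fun x y => ?_⟩
    obtain ⟨k, hk⟩ := ha x y
    obtain ⟨l, hl⟩ := hb x y
    exact ⟨k + l, by push_cast; rw [← hk, ← hl]; simp only [Pi.add_apply]; ring⟩
  neg_mem' := by
    rintro a ⟨ha₀, ha⟩
    refine ⟨by simp [ha₀], fun x y => ?_⟩
    obtain ⟨k, hk⟩ := ha x y
    exact ⟨-k, by push_cast; rw [← hk]; simp only [Pi.neg_apply]; ring⟩

namespace quasiHoms

variable {Λ}

/-- The additivity defect is an integer, so `Rat.num` extracts it without loss in `toCocycle`. -/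
theorem cast_num (h : quasiHoms Λ) (x y : Λ) :
    ((h.1 x + h.1 y - h.1 (x + y)).num : ℚ) = h.1 x + h.1 y - h.1 (x + y) := by
  obtain ⟨k, hk⟩ := h.2.2 x y
  rw [hk, Rat.num_intCast]

variable (Λ)

/-- The integral cocycle `h x + h y - h (x + y)`. -/
def toCocycle : quasiHoms Λ →+ ExtGroup.cocycles Λ ℤ :=
  AddMonoidHom.mk' (fun h => ⟨fun x y => (h.1 x + h.1 y - h.1 (x + y)).num, by
      refine ⟨fun x => ⟨?_, ?_⟩, fun x y z => ?_, fun x y => ?_⟩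
      · simp [h.2.1]
      · simp [h.2.1]
      · have : ((h.1 x + h.1 y - h.1 (x + y)).num : ℚ) +
            (h.1 (x + y) + h.1 z - h.1 (x + y + z)).num =
            (h.1 x + h.1 (y + z) - h.1 (x + (y + z))).num +
            (h.1 y + h.1 z - h.1 (y + z)).num := by
          rw [cast_num, cast_num, cast_num, cast_num, add_assoc x y z]
          ring
        exact_mod_cast this
      · change (h.1 x + h.1 y - h.1 (x + y)).num = (h.1 y + h.1 x - h.1 (y + x)).num
        rw [add_comm (h.1 x), add_comm x]⟩) fun a b => by
    refine Subtype.ext (funext fun x => funext fun y => ?_)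
    have : (((a + b).1 x + (a + b).1 y - (a + b).1 (x + y)).num : ℚ) =
        (a.1 x + a.1 y - a.1 (x + y)).num + (b.1 x + b.1 y - b.1 (x + y)).num := by
      rw [cast_num, cast_num, cast_num]
      simp only [AddSubgroup.coe_add, Pi.add_apply]
      ring
    exact_mod_cast this

theorem cast_toCocycle (h : quasiHoms Λ) (x y : Λ) :
    (((toCocycle Λ h).1 x y : ℤ) : ℚ) = h.1 x + h.1 y - h.1 (x + y) := cast_num h x y

/-- The reduction modulo `ℤ`. -/
def toChar : quasiHoms Λ →+ (Λ →+ AddCircle (1 : ℚ)) :=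
  AddMonoidHom.mk' (fun h => AddMonoidHom.mk' (fun x => (h.1 x : AddCircle (1 : ℚ))) fun x y => by
      obtain ⟨k, hk⟩ := h.2.2 x y
      rw [← AddCircle.coe_add, ← sub_eq_zero, ← neg_eq_zero, neg_sub, ← AddCircle.coe_sub, hk,
        ratCircle_coe_eq_zero_iff]
      exact ⟨k, rfl⟩) fun a b => rfl

theorem toChar_apply (h : quasiHoms Λ) (x : Λ) : toChar Λ h x = (h.1 x : AddCircle (1 : ℚ)) := rfl

/-- Over `ℚ` the cocycle is a coboundary of some `h`; integrality of the cocycle says that `h` is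
additive modulo `ℤ`. -/
theorem toCocycle_surjective : Function.Surjective (toCocycle Λ) := by
  intro c
  let c' : ExtGroup.cocycles Λ ℚ := ⟨fun x y => (c.1 x y : ℚ), by
    refine ⟨fun x => ⟨?_, ?_⟩, fun x y z => ?_, fun x y => ?_⟩
    · exact Int.cast_eq_zero.mpr (c.2.1 x).1
    · exact Int.cast_eq_zero.mpr (c.2.1 x).2
    · dsimp only
      exact_mod_cast c.2.2.1 x y z
    · exact congrArg Int.cast (c.2.2.2 x y)⟩
  obtain ⟨h, hh⟩ := ExtGroup.exists_eq_coboundary (IsDivisible.of_divisionRing ℚ) c'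
  replace hh : ∀ x y, (c.1 x y : ℚ) = h x + h y - h (x + y) := hh
  have h0 : h 0 = 0 := by
    have := hh 0 0
    rw [(c.2.1 0).1, add_zero, add_sub_cancel_right, Int.cast_zero] at this
    exact this.symm
  let q : quasiHoms Λ := ⟨h, h0, fun x y => ⟨c.1 x y, (hh x y).symm⟩⟩
  refine ⟨q, Subtype.ext (funext fun x => funext fun y => ?_)⟩
  have : (((toCocycle Λ q).1 x y : ℤ) : ℚ) = c.1 x y := by
    rw [cast_toCocycle, hh]
  exact_mod_cast this

theorem toChar_surjective : Function.Surjective (toChar Λ) := by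
  intro φ
  choose s hs using fun x => QuotientAddGroup.mk_surjective (φ x)
  -- Subtracting `s 0`, an integer because `φ 0 = 0`, normalizes the pointwise lift.
  have hs' : ∀ x, ((s x - s 0 : ℚ) : AddCircle (1 : ℚ)) = φ x := fun x => by
    rw [AddCircle.coe_sub]
    exact (congrArg₂ _ (hs x) (hs 0)).trans (by rw [map_zero, sub_zero])
  refine ⟨⟨fun x => s x - s 0, sub_self _, fun x y => ?_⟩, AddMonoidHom.ext hs'⟩
  rw [← ratCircle_coe_eq_zero_iff, AddCircle.coe_sub, AddCircle.coe_add, hs', hs', hs', map_add,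
    sub_self]

/-- Either condition says that `h` is the sum of an integer-valued function and a homomorphism `Λ →
ℚ`. -/
theorem ker_eq : ((QuotientAddGroup.mk' (ExtGroup.coboundaries Λ ℤ)).comp (toCocycle Λ)).ker =
    ((QuotientAddGroup.mk' (ratToChar Λ).range).comp (toChar Λ)).ker := by
  ext h
  rw [AddMonoidHom.mem_ker, AddMonoidHom.mem_ker]
  change (QuotientAddGroup.mk (toCocycle Λ h) : ExtGroup Λ ℤ) = 0 ↔
    (QuotientAddGroup.mk (toChar Λ h) : CharQuotient Λ) = 0
  rw [QuotientAddGroup.eq_zero_iff, QuotientAddGroup.eq_zero_iff]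
  constructor
  · rintro ⟨k, hk⟩
    refine ⟨AddMonoidHom.mk' (fun x => h.1 x - k x) fun x y => ?_, AddMonoidHom.ext fun x => ?_⟩
    · have h1 := cast_toCocycle Λ h x y
      rw [hk] at h1
      push_cast at h1
      linarith
    · rw [ratToChar_apply, toChar_apply, ← sub_eq_zero, ← AddCircle.coe_sub,
        ratCircle_coe_eq_zero_iff]
      exact ⟨-k x, by simp⟩
  · rintro ⟨g, hg⟩
    have hk : ∀ x, ∃ k : ℤ, h.1 x - g x = k := fun x => by
      rw [← ratCircle_coe_eq_zero_iff, AddCircle.coe_sub, ← toChar_apply, ← hg, ratToChar_apply,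
        sub_self]
    choose k hk using hk
    refine ⟨k, fun x y => ?_⟩
    have : (((toCocycle Λ h).1 x y : ℤ) : ℚ) = k x + k y - k (x + y) := by
      rw [cast_toCocycle, ← hk, ← hk, ← hk, map_add]
      ring
    exact_mod_cast this

end quasiHoms

/-- `Ext(Λ, ℤ)` is the cokernel of `Hom(Λ, ℚ) → Hom(Λ, ℚ / ℤ)`. -/
theorem exists_extGroup_equiv_charQuotient : Nonempty (ExtGroup Λ ℤ ≃+ CharQuotient Λ) := by
  have h₁ : Function.Surjective
      ((QuotientAddGroup.mk' (ExtGroup.coboundaries Λ ℤ)).comp (quasiHoms.toCocycle Λ)) :=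
    (QuotientAddGroup.mk'_surjective _).comp (quasiHoms.toCocycle_surjective Λ)
  have h₂ : Function.Surjective
      ((QuotientAddGroup.mk' (ratToChar Λ).range).comp (quasiHoms.toChar Λ)) :=
    (QuotientAddGroup.mk'_surjective _).comp (quasiHoms.toChar_surjective Λ)
  exact ⟨(QuotientAddGroup.quotientKerEquivOfSurjective _ h₁).symm.trans
    ((QuotientAddGroup.quotientAddEquivOfEq (quasiHoms.ker_eq Λ)).trans
      (QuotientAddGroup.quotientKerEquivOfSurjective _ h₂))⟩

end Extensions

/-! ### The completion as a group of characters -/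

namespace Cofiltration

variable {d : ℕ}

/-- The pairing of an integer vector with rational vectors. -/
def intPairing (x : Fin d → ℤ) : (Fin d → ℚ) →+ ℚ :=
  AddMonoidHom.mk' (fun y => ∑ i, (x i : ℚ) * y i) fun y z => by
    simp [mul_add, Finset.sum_add_distrib]

theorem intPairing_add (x x' : Fin d → ℤ) (y : Fin d → ℚ) :
    intPairing (x + x') y = intPairing x y + intPairing x' y := by
  simp [intPairing, add_mul, Finset.sum_add_distrib]

theorem intPairing_sub (x x' : Fin d → ℤ) (y : Fin d → ℚ) :
    intPairing (x - x') y = intPairing x y - intPairing x' y := by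
  simp [intPairing, sub_mul, Finset.sum_sub_distrib]

theorem intPairing_single (x : Fin d → ℤ) (i : Fin d) : intPairing x (Pi.single i 1) = x i := by
  simp [intPairing, Pi.single_apply]

/-- A homomorphism from a subgroup of `ℚ^d` to `ℚ` that takes integral values `z i` at the
standard basis vectors is the pairing with `z`. -/
theorem eq_intPairing (U : AddSubgroup (Fin d → ℚ)) (he : ∀ i, Pi.single i 1 ∈ U) (g : U →+ ℚ)
    (z : Fin d → ℤ) (hz : ∀ i, g ⟨Pi.single i 1, he i⟩ = z i) (y : U) :
    g y = intPairing z y := by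
  -- An extension of `g` to `ℚ^d` is automatically `ℚ`-linear, so the standard basis determines it.
  obtain ⟨f, hf⟩ := (IsDivisible.of_divisionRing ℚ).exists_extension U.subtype
    Subtype.val_injective g
  have hfz : f.toRatLinearMap = (intPairing z).toRatLinearMap := by
    refine LinearMap.pi_ext' fun i => LinearMap.ext_ring ?_
    change f (Pi.single i 1) = intPairing z (Pi.single i 1)
    rw [intPairing_single, ← hz]
    exact hf ⟨Pi.single i 1, he i⟩
  rw [← hf y]
  exact LinearMap.congr_fun hfz y

variable (F : Cofiltration d)

theorem mem_dual_iff {m : ℕ} {x : Fin d → ℤ} :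
    x ∈ F.dual m ↔ ∀ y ∈ F.term m, (intPairing x y : AddCircle (1 : ℚ)) = 0 :=
  forall₂_congr fun _ _ => (ratCircle_coe_eq_zero_iff _).symm

theorem mk_eq_mk_iff {m : ℕ} {v w : Fin d → ℤ} :
    (QuotientAddGroup.mk v : (Fin d → ℤ) ⧸ F.dual m) = QuotientAddGroup.mk w ↔
      ∀ y ∈ F.term m, (intPairing v y : AddCircle (1 : ℚ)) = intPairing w y := by
  rw [← sub_eq_zero, ← QuotientAddGroup.mk_sub, QuotientAddGroup.eq_zero_iff, mem_dual_iff]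
  refine forall₂_congr fun y _ => ?_
  rw [intPairing_sub, AddCircle.coe_sub, sub_eq_zero]

theorem mem_union_iff {y : Fin d → ℚ} : y ∈ F.union ↔ ∃ m, y ∈ F.term m :=
  AddSubgroup.mem_iSup_of_directed F.mono.directed_le

theorem single_mem_term (m : ℕ) (i : Fin d) : Pi.single i 1 ∈ F.term m := by
  refine F.mono (Nat.zero_le m) ?_
  rw [F.term_zero]
  refine ⟨Pi.single i 1, funext fun j => ?_⟩
  by_cases h : j = i
  · subst h; simp
  · simp [h]

theorem single_mem_union (i : Fin d) : Pi.single i 1 ∈ F.union :=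
  F.mem_union_iff.mpr ⟨0, F.single_mem_term 0 i⟩

theorem completion_mk_eq (x : F.completion) {m n : ℕ} (h : m ≤ n) {v : Fin d → ℤ}
    (hv : QuotientAddGroup.mk v = x.1 n) : QuotientAddGroup.mk v = x.1 m := by
  rw [← x.2 m n h, ← hv]
  rfl

theorem intPairing_eq_of_mk_eq (x : F.completion) {m n : ℕ} {v w : Fin d → ℤ}
    (hv : QuotientAddGroup.mk v = x.1 m) (hw : QuotientAddGroup.mk w = x.1 n)
    {y : Fin d → ℚ} (hm : y ∈ F.term m) (hn : y ∈ F.term n) :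
    (intPairing v y : AddCircle (1 : ℚ)) = intPairing w y := by
  rcases le_total m n with h | h
  · exact F.mk_eq_mk_iff.mp (hv.trans (F.completion_mk_eq x h hw).symm) y hm
  · exact F.mk_eq_mk_iff.mp ((F.completion_mk_eq x h hv).trans hw.symm) y hn

/-- An index of a term that contains a given element of the union. -/
noncomputable def level (y : F.union) : ℕ := (F.mem_union_iff.mp y.2).choose

theorem mem_level (y : F.union) : (y : Fin d → ℚ) ∈ F.term (F.level y) :=
  (F.mem_union_iff.mp y.2).choose_spec

/-- The value at `y` of the character of the union defined by `x`. -/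
noncomputable def charValue (x : F.completion) (y : F.union) : AddCircle (1 : ℚ) :=
  (intPairing (x.1 (F.level y)).out y : ℚ)

/-- Neither the chosen level nor the representative matters, so additivity can be checked on one
common term. -/
theorem charValue_eq (x : F.completion) (y : F.union) {m : ℕ} {v : Fin d → ℤ}
    (hv : QuotientAddGroup.mk v = x.1 m) (hy : (y : Fin d → ℚ) ∈ F.term m) :
    F.charValue x y = intPairing v y :=
  F.intPairing_eq_of_mk_eq x (QuotientAddGroup.out_eq' _) hv (F.mem_level y) hy

/-- The homomorphism from the completion to the characters of the union. -/
noncomputable def toUnionChar : F.completion →+ (F.union →+ AddCircle (1 : ℚ)) :=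
  AddMonoidHom.mk' (fun x => AddMonoidHom.mk' (F.charValue x) fun y z => by
      let m := max (F.level y) (F.level z)
      have hy : (y : Fin d → ℚ) ∈ F.term m := F.mono (le_max_left _ _) (F.mem_level y)
      have hz : (z : Fin d → ℚ) ∈ F.term m := F.mono (le_max_right _ _) (F.mem_level z)
      have hv : QuotientAddGroup.mk (x.1 m).out = x.1 m := QuotientAddGroup.out_eq' _
      rw [F.charValue_eq x y hv hy, F.charValue_eq x z hv hz,
        F.charValue_eq x (y + z) hv (add_mem hy hz), AddSubgroup.coe_add, map_add,
        AddCircle.coe_add]) fun x x' => AddMonoidHom.ext fun y => by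
    have hy := F.mem_level y
    have hv : QuotientAddGroup.mk (x.1 (F.level y)).out = x.1 (F.level y) :=
      QuotientAddGroup.out_eq' _
    have hv' : QuotientAddGroup.mk (x'.1 (F.level y)).out = x'.1 (F.level y) :=
      QuotientAddGroup.out_eq' _
    have h : QuotientAddGroup.mk ((x.1 (F.level y)).out + (x'.1 (F.level y)).out) =
        (x + x').1 (F.level y) := by
      rw [QuotientAddGroup.mk_add, hv, hv']
      rfl
    change F.charValue (x + x') y = F.charValue x y + F.charValue x' y
    rw [F.charValue_eq _ y h hy, F.charValue_eq x y hv hy, F.charValue_eq x' y hv' hy,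
      intPairing_add, AddCircle.coe_add]

theorem toUnionChar_apply (x : F.completion) (y : F.union) {m : ℕ} {v : Fin d → ℤ}
    (hv : QuotientAddGroup.mk v = x.1 m) (hy : (y : Fin d → ℚ) ∈ F.term m) :
    F.toUnionChar x y = intPairing v y := F.charValue_eq x y hv hy

/-- Characters from the completion vanish on `ℤ^d`, so a rational lift is integral there and is the
pairing with some `z ∈ ℤ^d`; then `x` is the image of `z`. -/
theorem ker_toUnionChar : F.toCompletion.range =
    ((QuotientAddGroup.mk' (ratToChar F.union).range).comp F.toUnionChar).ker := by
  ext x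
  rw [AddMonoidHom.mem_ker]
  change _ ↔ (QuotientAddGroup.mk (F.toUnionChar x) : CharQuotient F.union) = 0
  rw [QuotientAddGroup.eq_zero_iff]
  constructor
  · rintro ⟨z, rfl⟩
    refine ⟨(intPairing z).comp F.union.subtype, AddMonoidHom.ext fun y => ?_⟩
    rw [F.toUnionChar_apply (F.toCompletion z) y rfl (F.mem_level y)]
    rfl
  · rintro ⟨g, hg⟩
    have hg' : ∀ y, F.toUnionChar x y = (g y : AddCircle (1 : ℚ)) := fun y => by
      rw [← hg, ratToChar_apply]
    choose v hv using fun m => QuotientAddGroup.mk_surjective (x.1 m)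
    have hz : ∀ i, ∃ k : ℤ, g ⟨Pi.single i 1, F.single_mem_union i⟩ = k := fun i => by
      rw [← ratCircle_coe_eq_zero_iff, ← hg',
        F.toUnionChar_apply x _ (hv 0) (F.single_mem_term 0 i), intPairing_single,
        ratCircle_coe_eq_zero_iff]
      exact ⟨_, rfl⟩
    choose z hz using hz
    refine ⟨z, Subtype.ext (funext fun m => ?_)⟩
    rw [← hv m]
    refine F.mk_eq_mk_iff.mpr fun y hy => ?_
    have hyU := F.mem_union_iff.mpr ⟨m, hy⟩
    rw [← eq_intPairing F.union F.single_mem_union g z hz ⟨y, hyU⟩, ← hg',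
      F.toUnionChar_apply x ⟨y, hyU⟩ (hv m) hy]

/-- A character of the union that is trivial on `ℤ^d` is represented on each term by an integer
vector. -/
theorem exists_intPairing_eq (χ : F.union →+ AddCircle (1 : ℚ))
    (hχ : ∀ i, χ ⟨Pi.single i 1, F.single_mem_union i⟩ = 0) (m : ℕ) :
    ∃ v : Fin d → ℤ, ∀ (y : F.union), (y : Fin d → ℚ) ∈ F.term m →
      χ y = (intPairing v y : AddCircle (1 : ℚ)) := by
  have hfg : AddGroup.FG (F.term m) := (AddGroup.fg_iff_addSubgroup_fg _).mpr (F.fg m)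
  have hfin : Module.Finite ℤ (F.term m) := Module.Finite.iff_addGroup_fg.mpr hfg
  have hle : F.term m ≤ F.union := fun y hy => F.mem_union_iff.mpr ⟨m, hy⟩
  -- A finitely generated subgroup of `ℚ^d` is free, so `χ` lifts to `ℚ` on it; the lift is integral
  -- at the basis vectors, where `χ` vanishes.
  obtain ⟨g, hg⟩ := Module.projective_lifting_property
    (QuotientAddGroup.mk' (AddSubgroup.zmultiples (1 : ℚ))).toIntLinearMap
    (χ.comp (AddSubgroup.inclusion hle)).toIntLinearMap (QuotientAddGroup.mk'_surjective _)
  have hg' : ∀ y : F.term m, (g y : AddCircle (1 : ℚ)) = χ ⟨y, hle y.2⟩ := fun y =>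
    LinearMap.congr_fun hg y
  have hz : ∀ i, ∃ k : ℤ, g ⟨Pi.single i 1, F.single_mem_term m i⟩ = k := fun i => by
    rw [← ratCircle_coe_eq_zero_iff, hg']
    exact hχ i
  choose v hv using hz
  refine ⟨v, fun y hy => ?_⟩
  rw [← eq_intPairing (F.term m) (F.single_mem_term m) g.toAddMonoidHom v hv ⟨y, hy⟩]
  exact (hg' ⟨y, hy⟩).symm

/-- Subtracting the pairing with a rational vector that lifts the values of `χ` on the basis makes
`χ` trivial on `ℤ^d`; the integer vectors representing it on the terms are then compatible. -/
theorem toUnionChar_surjective : Function.Surjective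
    ((QuotientAddGroup.mk' (ratToChar F.union).range).comp F.toUnionChar) := by
  intro a
  obtain ⟨χ, rfl⟩ := QuotientAddGroup.mk_surjective a
  choose q hq using fun i => QuotientAddGroup.mk_surjective
    (χ ⟨Pi.single i 1, F.single_mem_union i⟩)
  let g : F.union →+ ℚ := AddMonoidHom.mk' (fun y => ∑ i, q i * y.1 i) fun y z => by
    simp [mul_add, Finset.sum_add_distrib]
  have hg : ∀ i, (χ - ratToChar _ g) ⟨Pi.single i 1, F.single_mem_union i⟩ = 0 := fun i => by
    have h1 : g ⟨Pi.single i 1, F.single_mem_union i⟩ = q i := by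
      simp [g, Pi.single_apply]
    rw [AddMonoidHom.sub_apply, ratToChar_apply, h1, sub_eq_zero]
    exact (hq i).symm
  choose v hv using F.exists_intPairing_eq _ hg
  let x : F.completion := ⟨fun m => QuotientAddGroup.mk (v m), fun m n h => by
    refine F.mk_eq_mk_iff.mpr fun y hy => ?_
    have hyU := F.mem_union_iff.mpr ⟨m, hy⟩
    exact (hv n ⟨y, hyU⟩ (F.mono h hy)).symm.trans (hv m ⟨y, hyU⟩ hy)⟩
  have hx : F.toUnionChar x = χ - ratToChar _ g := AddMonoidHom.ext fun y => by
    rw [F.toUnionChar_apply x y rfl (F.mem_level y), hv _ y (F.mem_level y)]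
  refine ⟨x, ?_⟩
  change (QuotientAddGroup.mk (F.toUnionChar x) : CharQuotient F.union) = QuotientAddGroup.mk χ
  rw [QuotientAddGroup.eq, hx]
  exact ⟨g, by abel⟩

/-- The quotient of the completion by `ℤ^d` is the cokernel of
`Hom(Λ, ℚ) → Hom(Λ, ℚ / ℤ)` for the union `Λ` of the cofiltration. -/
theorem exists_completionQuotient_equiv_charQuotient :
    Nonempty (F.completionQuotient ≃+ CharQuotient F.union) :=
  ⟨(QuotientAddGroup.quotientAddEquivOfEq F.ker_toUnionChar).trans
    (QuotientAddGroup.quotientKerEquivOfSurjective _ F.toUnionChar_surjective)⟩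

end Cofiltration

/-! ### Classification -/

section Classification

variable {Λ : Type*} [AddCommGroup Λ] [IsAddTorsionFree Λ] {d : ℕ}

theorem exists_extGroup_equiv_modelGroup (hd : 1 ≤ d) (hr : Module.rank ℤ Λ = d)
    (h : NoFreeSummand Λ) : Nonempty (ExtGroup Λ ℤ ≃+ ModelGroup (fun p => pCorank p Λ)) := by
  obtain ⟨e⟩ := exists_extGroup_equiv_charQuotient Λ
  obtain ⟨e'⟩ := exists_charQuotient_equiv_modelGroup hd hr h
  exact ⟨e.trans e'⟩

theorem card_extGroup_torsion (h : NoFreeSummand Λ) (p : Nat.Primes)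
    (hr : Module.rank ℤ Λ = d) :
    Nat.card {x : ExtGroup Λ ℤ // (p : ℕ) • x = 0} = pIndex p Λ := by
  obtain ⟨e⟩ := exists_extGroup_equiv_charQuotient Λ
  rw [pIndex_eq_pow p hr, ← card_charQuotient_torsion h p hr]
  refine Nat.card_congr (e.toEquiv.subtypeEquiv fun x => ?_)
  change _ ↔ (p : ℕ) • e x = 0
  rw [← map_nsmul, e.map_eq_zero_iff]

theorem pCorank_eq_of_pIndex_eq {Λ' : Type*} [AddCommGroup Λ'] [IsAddTorsionFree Λ'] {d' : ℕ}
    (hr : Module.rank ℤ Λ = d) (hr' : Module.rank ℤ Λ' = d')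
    (p : Nat.Primes) (h : pIndex p Λ = pIndex p Λ') : pCorank p Λ = pCorank p Λ' := by
  rw [pIndex_eq_pow p hr, pIndex_eq_pow p hr'] at h
  exact Nat.pow_right_injective p.2.two_le h

end Classification

theorem mainTheorem10 :
    -- the quotient of the completion by `ℤ^d`, for a rank `d` subgroup `Λ` of `ℚ^d`
    (∀ (d : ℕ) (Λ : AddSubgroup (Fin d → ℚ)), 1 ≤ d → Module.rank ℤ Λ = d → NoFreeSummand Λ →
      (∀ p : Nat.Primes, pCorank p Λ ≤ d ∧ pIndex p Λ = (p : ℕ) ^ pCorank p Λ) ∧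
      ∀ F : Cofiltration d, Nonempty (F.union ≃+ Λ) →
        Nonempty (F.completionQuotient ≃+ ModelGroup (fun p => pCorank p Λ))) ∧
    -- the group `Ext(Λ, ℤ)`
    (∀ (d : ℕ) (Λ : Type*) [AddCommGroup Λ] [IsAddTorsionFree Λ],
      1 ≤ d → Module.rank ℤ Λ = d → NoFreeSummand Λ →
      (∀ p : Nat.Primes, pCorank p Λ ≤ d ∧ pIndex p Λ = (p : ℕ) ^ pCorank p Λ) ∧
      Nonempty (ExtGroup Λ ℤ ≃+ ModelGroup (fun p => pCorank p Λ))) ∧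
    -- the isomorphism classification of the groups `Ext(Λ, ℤ)`
    (∀ (d d' : ℕ) (Λ Λ' : Type*) [AddCommGroup Λ] [IsAddTorsionFree Λ]
      [AddCommGroup Λ'] [IsAddTorsionFree Λ'],
      1 ≤ d → Module.rank ℤ Λ = d → NoFreeSummand Λ →
      1 ≤ d' → Module.rank ℤ Λ' = d' → NoFreeSummand Λ' →
      (Nonempty (ExtGroup Λ ℤ ≃+ ExtGroup Λ' ℤ) ↔
        ∀ p : Nat.Primes, pIndex p Λ = pIndex p Λ')) := by
  refine ⟨fun d Λ hd hr h => ?_, fun d Λ _ _ hd hr h => ?_,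
    fun d d' Λ Λ' _ _ _ _ hd hr h hd' hr' h' => ⟨?_, fun hp => ?_⟩⟩
  · have htf : IsAddTorsionFree (Fin d → ℚ) := IsAddTorsionFree.of_module_rat _
    refine ⟨fun p => ⟨pCorank_le p hr, pIndex_eq_pow p hr⟩, ?_⟩
    rintro F ⟨e⟩
    have hrU : Module.rank ℤ F.union = d := by
      rw [← hr]
      exact e.toIntLinearEquiv.rank_eq
    -- The index passes through the isomorphism, and the corank is its exponent of `p`.
    have hcorank : ∀ p : Nat.Primes, pCorank p F.union = pCorank p Λ := fun p =>
      pCorank_eq_of_pIndex_eq hrU hr p (pIndex_congr e p)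
    obtain ⟨s⟩ := F.exists_completionQuotient_equiv_charQuotient
    obtain ⟨t⟩ := exists_charQuotient_equiv_modelGroup hd hrU F.noFreeSummand
    rw [funext hcorank] at t
    exact ⟨s.trans t⟩
  · exact ⟨fun p => ⟨pCorank_le p hr, pIndex_eq_pow p hr⟩,
      exists_extGroup_equiv_modelGroup hd hr h⟩
  -- An isomorphism preserves the order of the `p`-torsion, which is the index.
  · rintro ⟨e⟩ p
    rw [← card_extGroup_torsion h p hr, ← card_extGroup_torsion h' p hr']
    refine Nat.card_congr (e.toEquiv.subtypeEquiv fun x => ?_)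
    change _ ↔ (p : ℕ) • e x = 0
    rw [← map_nsmul, e.map_eq_zero_iff]
  · obtain ⟨s⟩ := exists_extGroup_equiv_modelGroup hd hr h
    obtain ⟨s'⟩ := exists_extGroup_equiv_modelGroup hd' hr' h'
    rw [funext fun p => pCorank_eq_of_pIndex_eq hr hr' p (hp p)] at s
    exact ⟨s.trans s'.symm⟩
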